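/- Let $p$ be a prime and $K$ a field of characteristic $p$. For positive integers $S,R$ let $\mathcal R$ be the divided power algebra with $K$-basis the monomials $\prod_{i\ge 0} x_i^{(\alpha_i)}y_i^{(\beta_i)}z_i^{(\gamma_i)}$, where $0\le\alpha_i<p^{S}$, $0\le\beta_i,\gamma_i<p^{R}$ and almost all exponents are $0$. The product in each variable is $t^{(i)}t^{(j)}=\binom{i+j}{i}t^{(i+j)}$, read as $0$ when $i+j$ is out of range. Let $\partial_t$ be the derivation of $\mathcal R$ with $\partial_t(t^{(i)})=t^{(i-1)}$, $\partial_t(t^{(0)})=0$, that kills the divided powers of the other variables. Define derivations of $\mathcal R$ for $i\ge 0$ by $$v_i=\partial_{x_i}+x_i^{(p^S-1)}y_i^{(p^R-1)}v_{i+1},\qquad w_i=\partial_{y_i}+y_i^{(p^R-1)}x_i^{(p^S-1)}w_{i+1},\qquad u_i=\partial_{z_i}+z_i^{(p^R-1)}x_i^{(p^S-1)}u_{i+1},$$ where each recursion is expanded into an infinite sum, of which only finitely many terms act nontrivially on any given element of $\mathcal R$. The clover restricted Lie algebra of the constant tuple $(S,R)$ is $\mathbf T(S,R)=\mathrm{Lie}_p(v_0,w_0,u_0)\subset\mathrm{Der}\,\mathcal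 R$, the smallest subspace containing $X=\{v_0,w_0,u_0\}$ and closed under commutators and $p$-th powers. Its growth function is $$\gamma(n)=\dim_K\big\langle [a_1,\dots,a_s]^{p^k}\ \big|\ a_j\in X,\ s\ge 1,\ k\ge 0,\ s\,p^k\le n\big\rangle_K ,$$ where $[a_1,\dots,a_s]=[a_1,[a_2,\dots,a_s]]$ is the right-normed commutator, and $\mathrm{GKdim}\,\mathbf T(S,R)=\limsup_{n\to\infty}\frac{\ln\gamma(n)}{\ln n}$. Then the set $\{\mathrm{GKdim}\,\mathbf T(S,R)\mid S,R\ge 1\}$ is contained in $[1,3]$ and is dense in $[1,3]$. -/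

import Mathlib

open Filter Set

attribute [local instance 100] LieRing.ofAssociativeRing

noncomputable section

/-! ### Divided power algebras -/

section DividedPowers

variable {Θ : Type*} (p : ℕ) (H : Θ → ℕ)

/-- The exponents of divided power monomials: finitely supported `α`
with `0 ≤ α a < p ^ H a` for every variable `a`. -/
abbrev DPExp : Type _ := {α : Θ →₀ ℕ // ∀ a, α a < p ^ H a}

variable (K : Type*) [Field K]

/-- The divided power algebra `R(Θ, H)`: the `K`-vector space with basis the formal monomials
`∏ t_a^{(α a)}`, `α` in `DPExp p H`. -/
def DP : Type _ := DPExp p H →₀ K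

instance : AddCommGroup (DP p H K) := inferInstanceAs (AddCommGroup (DPExp p H →₀ K))
instance : Module K (DP p H K) := inferInstanceAs (Module K (DPExp p H →₀ K))

/-- The basis of monomials. -/
def DP.basis : Module.Basis (DPExp p H) K (DP p H K) :=
  (Finsupp.basisSingleOne : Module.Basis (DPExp p H) K (DPExp p H →₀ K))

open Classical in
/-- The monomial `∏ t_a^{(α a)}`, understood as `0` if some exponent is out of range. -/
def DP.mono (α : Θ →₀ ℕ) : DP p H K :=
  if h : ∀ a, α a < p ^ H a then DP.basis p H K ⟨α, h⟩ else 0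

/-- The structure constant `∏ binom(α a + β a, α a)`. -/
def DP.coef (α β : Θ →₀ ℕ) : ℕ := (α + β).prod fun a n => n.choose (α a)

/-- Multiplication, on monomials:
`(∏ t_a^{(α a)}) (∏ t_a^{(β a)}) = ∏ binom(α a + β a, α a) t_a^{(α a + β a)}`. -/
def DP.mulMap : DP p H K →ₗ[K] DP p H K →ₗ[K] DP p H K :=
  (DP.basis p H K).constr K fun α => (DP.basis p H K).constr K fun β =>
    (DP.coef α.1 β.1 : K) • DP.mono p H K (α.1 + β.1)

instance : Mul (DP p H K) := ⟨fun f g => DP.mulMap p H K f g⟩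
instance : One (DP p H K) := ⟨DP.mono p H K 0⟩

variable {p H K}

theorem DP.basis_eq (α : DPExp p H) : DP.basis p H K α = DP.mono p H K α.1 := by
  unfold DP.mono
  rw [dif_pos α.2]

theorem DP.constr_mono {M : Type*} [AddCommGroup M] [Module K M] (g : DPExp p H → M)
    (α : DPExp p H) : (DP.basis p H K).constr K g (DP.mono p H K α.1) = g α := by
  rw [← DP.basis_eq, Module.Basis.constr_basis]

theorem DP.mono_eq_zero {α : Θ →₀ ℕ} (h : ¬ ∀ a, α a < p ^ H a) : DP.mono p H K α = 0 :=
  dif_neg h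

theorem DP.hom_ext {M : Type*} [AddCommGroup M] [Module K M] {f g : DP p H K →ₗ[K] M}
    (h : ∀ α : DPExp p H, f (DP.mono p H K α.1) = g (DP.mono p H K α.1)) : f = g :=
  (DP.basis p H K).ext fun α => by rw [DP.basis_eq]; exact h α

theorem DP.mono_mul_mono (α β : Θ →₀ ℕ) : DP.mono p H K α * DP.mono p H K β =
    (DP.coef α β : K) • DP.mono p H K (α + β) := by
  change DP.mulMap p H K _ _ = _
  by_cases hα : ∀ a, α a < p ^ H a
  · by_cases hβ : ∀ a, β a < p ^ H a
    · unfold DP.mulMap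
      have h1 := DP.constr_mono (K := K) (fun α : DPExp p H => (DP.basis p H K).constr K
        fun β : DPExp p H => (DP.coef α.1 β.1 : K) • DP.mono p H K (α.1 + β.1)) ⟨α, hα⟩
      have h2 := DP.constr_mono (K := K) (fun β : DPExp p H =>
        (DP.coef α β.1 : K) • DP.mono p H K (α + β.1)) ⟨β, hβ⟩
      rw [h1]
      exact h2
    · have h0 : DP.mono p H K (α + β) = 0 := DP.mono_eq_zero fun h =>
        hβ fun a => lt_of_le_of_lt (by simp) (h a)
      rw [DP.mono_eq_zero hβ, h0, map_zero, smul_zero]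
  · have h0 : DP.mono p H K (α + β) = 0 := DP.mono_eq_zero fun h =>
      hα fun a => lt_of_le_of_lt (by simp) (h a)
    rw [DP.mono_eq_zero hα, h0, map_zero, smul_zero, LinearMap.zero_apply]

theorem DP.coef_eq (α β : Θ →₀ ℕ) (s : Finset Θ) (hs : ∀ a ∉ s, α a = 0 ∧ β a = 0) :
    DP.coef α β = ∏ a ∈ s, (α a + β a).choose (α a) := by
  unfold DP.coef Finsupp.prod
  refine Finset.prod_subset (fun a ha => ?_) (fun a _ ha => ?_)
  · by_contra h
    simp [hs a h] at ha
  · have : α a = 0 ∧ β a = 0 := by simpa using ha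
    simp [this]

theorem DP.exists_common (α β γ : Θ →₀ ℕ) : ∃ s : Finset Θ,
    ∀ a ∉ s, α a = 0 ∧ β a = 0 ∧ γ a = 0 := by
  classical
  refine ⟨α.support ∪ β.support ∪ γ.support, fun a ha => ?_⟩
  simp only [Finset.mem_union, Finsupp.mem_support_iff, not_or, not_not] at ha
  exact ⟨ha.1.1, ha.1.2, ha.2⟩

theorem DP.coef_comm (α β : Θ →₀ ℕ) : DP.coef α β = DP.coef β α := by
  obtain ⟨s, hs⟩ := DP.exists_common α β 0
  rw [DP.coef_eq α β s fun a ha => ⟨(hs a ha).1, (hs a ha).2.1⟩,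
    DP.coef_eq β α s fun a ha => ⟨(hs a ha).2.1, (hs a ha).1⟩]
  refine Finset.prod_congr rfl fun a _ => ?_
  rw [add_comm, Nat.choose_symm_add]

theorem DP.coef_assoc (α β γ : Θ →₀ ℕ) :
    DP.coef α β * DP.coef (α + β) γ = DP.coef β γ * DP.coef α (β + γ) := by
  obtain ⟨s, hs⟩ := DP.exists_common α β γ
  rw [DP.coef_eq α β s fun a ha => ⟨(hs a ha).1, (hs a ha).2.1⟩,
    DP.coef_eq (α + β) γ s fun a ha => by simp [hs a ha],
    DP.coef_eq β γ s fun a ha => by simp [hs a ha],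
    DP.coef_eq α (β + γ) s fun a ha => by simp [hs a ha],
    ← Finset.prod_mul_distrib, ← Finset.prod_mul_distrib]
  refine Finset.prod_congr rfl fun a _ => ?_
  simp only [Finsupp.add_apply]
  have h1 := Nat.choose_mul (n := α a + β a + γ a) (k := α a + β a) (s := α a)
    (Nat.le_add_right _ _)
  rw [show α a + β a + γ a - α a = β a + γ a by omega,
    show α a + β a - α a = β a by omega] at h1
  rw [← add_assoc, mul_comm, h1, mul_comm]

theorem DP.one_def : (1 : DP p H K) = DP.mono p H K 0 := rfl

theorem DP.mul_eq (f g : DP p H K) : f * g = DP.mulMap p H K f g := rfl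

theorem DP.mul_comm' (f g : DP p H K) : f * g = g * f := by
  have : DP.mulMap p H K = (DP.mulMap p H K).flip := DP.hom_ext fun α => DP.hom_ext fun β => by
    change DP.mono p H K α.1 * DP.mono p H K β.1 = DP.mono p H K β.1 * DP.mono p H K α.1
    rw [DP.mono_mul_mono, DP.mono_mul_mono, DP.coef_comm, add_comm]
  exact congrArg (fun F => F f g) this

theorem DP.induction {P : DP p H K → Prop} (f : DP p H K) (h0 : P 0)
    (hadd : ∀ f g, P f → P g → P (f + g))
    (hmono : ∀ (c : K) (α : DPExp p H), P (c • DP.mono p H K α.1)) : P f := by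
  have hf : f ∈ Submodule.span K (Set.range (DP.basis p H K)) := by
    rw [(DP.basis p H K).span_eq]
    exact Submodule.mem_top
  have : ∀ c : K, P (c • f) := by
    induction hf using Submodule.span_induction with
    | mem x hx =>
      obtain ⟨α, rfl⟩ := hx
      intro c
      rw [DP.basis_eq]
      exact hmono c α
    | zero => simpa using h0
    | add x y _ _ hx hy =>
      intro c
      rw [smul_add]
      exact hadd _ _ (hx c) (hy c)
    | smul a x _ hx =>
      intro c
      rw [smul_smul]
      exact hx _
  simpa using this 1

theorem DP.add_mul' (f g h : DP p H K) : (f + g) * h = f * h + g * h := by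
  simp [DP.mul_eq]

theorem DP.mul_add' (f g h : DP p H K) : f * (g + h) = f * g + f * h := by
  simp [DP.mul_eq]

theorem DP.smul_mul' (c : K) (f g : DP p H K) : (c • f) * g = c • (f * g) := by
  simp [DP.mul_eq]

theorem DP.mul_smul' (c : K) (f g : DP p H K) : f * (c • g) = c • (f * g) := by
  simp [DP.mul_eq]

theorem DP.zero_mul' (f : DP p H K) : 0 * f = 0 := by
  simp [DP.mul_eq]

theorem DP.mul_zero' (f : DP p H K) : f * 0 = 0 := by
  simp [DP.mul_eq]

theorem DP.mul_assoc' (f g h : DP p H K) : f * g * h = f * (g * h) := by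
  induction f using DP.induction with
  | h0 => simp only [DP.zero_mul']
  | hadd a b ha hb => simp only [DP.add_mul', ha, hb]
  | hmono c α =>
    induction g using DP.induction with
    | h0 => simp only [DP.zero_mul', DP.mul_zero']
    | hadd a b ha hb => simp only [DP.add_mul', DP.mul_add', ha, hb]
    | hmono d β =>
      induction h using DP.induction with
      | h0 => simp only [DP.mul_zero']
      | hadd a b ha hb => simp only [DP.mul_add', ha, hb]
      | hmono e γ =>
        simp only [DP.smul_mul', DP.mul_smul', DP.mono_mul_mono, smul_smul, ← add_assoc]
        congr 1
        have := congrArg (Nat.cast (R := K)) (DP.coef_assoc α.1 β.1 γ.1)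
        push_cast at this
        linear_combination (c * d * e) * this

theorem DP.one_mul' (f : DP p H K) : 1 * f = f := by
  induction f using DP.induction with
  | h0 => simp only [DP.mul_zero']
  | hadd a b ha hb => simp only [DP.mul_add', ha, hb]
  | hmono c α =>
    have : DP.coef 0 α.1 = 1 := by
      unfold DP.coef Finsupp.prod
      simp
    simp [DP.one_def, DP.mul_smul', DP.mono_mul_mono, this]

instance : CommRing (DP p H K) where
  __ := (inferInstance : AddCommGroup (DP p H K))
  mul_assoc := DP.mul_assoc'
  one_mul := DP.one_mul'
  mul_one f := by rw [DP.mul_comm', DP.one_mul']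
  left_distrib := DP.mul_add'
  right_distrib := DP.add_mul'
  zero_mul := DP.zero_mul'
  mul_zero := DP.mul_zero'
  mul_comm := DP.mul_comm'

instance : Algebra K (DP p H K) := Algebra.ofModule DP.smul_mul' fun c f g => DP.mul_smul' c f g

/-! ### Derivations of divided power algebras -/

variable (p H K) in
/-- The linear map `∂_a`, lowering the exponent of `t_a` by one:
`t_a^{(i)} ↦ t_a^{(i-1)}` and `t_a^{(0)} ↦ 0`. -/
def DP.partialMap (a : Θ) : DP p H K →ₗ[K] DP p H K :=
  (DP.basis p H K).constr K fun α =>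
    if α.1 a = 0 then 0 else DP.mono p H K (α.1 - Finsupp.single a 1)

theorem DP.sub_add_single {α : Θ →₀ ℕ} {a : Θ} (h : α a ≠ 0) :
    α - Finsupp.single a 1 + Finsupp.single a 1 = α := by
  refine tsub_add_cancel_of_le fun b => ?_
  by_cases hb : a = b
  · subst hb
    simpa [Nat.one_le_iff_ne_zero] using h
  · simp [hb]

theorem DP.partialMap_mono (a : Θ) (α : DPExp p H) : DP.partialMap p H K a (DP.mono p H K α.1) =
    if α.1 a = 0 then 0 else DP.mono p H K (α.1 - Finsupp.single a 1) :=
  DP.constr_mono _ α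

theorem DP.partialMap_coef [Fact p.Prime] [CharP K p] (a : Θ) (α β : DPExp p H) :
    DP.partialMap p H K a ((DP.coef α.1 β.1 : K) • DP.mono p H K (α.1 + β.1)) =
    (DP.coef α.1 β.1 : K) •
      if (α.1 + β.1) a = 0 then 0 else DP.mono p H K (α.1 + β.1 - Finsupp.single a 1) := by
  rw [map_smul]
  by_cases h : ∀ b, (α.1 + β.1) b < p ^ H b
  · have := DP.partialMap_mono (K := K) a ⟨α.1 + β.1, h⟩
    rw [this]
  · rw [DP.mono_eq_zero h, map_zero, smul_zero]
    split_ifs with h1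
    · simp
    by_cases h2 : ∀ b, (α.1 + β.1 - Finsupp.single a 1 : Θ →₀ ℕ) b < p ^ H b
    · push Not at h
      obtain ⟨b, hb⟩ := h
      have h3 := h2 b
      have hab : a = b := by
        by_contra hab
        simp [hab] at h3 hb
        omega
      subst hab
      have hp := α.2 a
      have hq := β.2 a
      have h4 : α.1 a + β.1 a = p ^ H a := by
        simp at h3 hb
        omega
      have hz : p ∣ DP.coef α.1 β.1 := by
        obtain ⟨s, hs⟩ := DP.exists_common α.1 β.1 0
        rw [DP.coef_eq α.1 β.1 s fun a ha => ⟨(hs a ha).1, (hs a ha).2.1⟩]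
        have ha : a ∈ s := by
          by_contra ha
          exact h1 (by simp [hs a ha])
        refine dvd_trans ?_ (Finset.dvd_prod_of_mem _ ha)
        rw [h4]
        exact (Fact.out : p.Prime).dvd_choose_pow (by omega) (by omega)
      rw [(CharP.cast_eq_zero_iff K p _).2 hz, zero_smul]
    · rw [DP.mono_eq_zero h2, smul_zero]

theorem DP.coef_pascal (α β : Θ →₀ ℕ) (a : Θ) (hα : α a ≠ 0) (hβ : β a ≠ 0) :
    DP.coef α β = DP.coef α (β - Finsupp.single a 1) + DP.coef (α - Finsupp.single a 1) β := by
  classical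
  obtain ⟨s, hs⟩ := DP.exists_common α β 0
  have ha : a ∈ s := by
    by_contra ha
    exact hα (hs a ha).1
  rw [DP.coef_eq α β s fun a ha => ⟨(hs a ha).1, (hs a ha).2.1⟩,
    DP.coef_eq α _ s fun a ha => by simp [hs a ha],
    DP.coef_eq _ β s fun a ha => by simp [hs a ha],
    ← Finset.mul_prod_erase s _ ha, ← Finset.mul_prod_erase s _ ha,
    ← Finset.mul_prod_erase s _ ha]
  have e1 : ∏ x ∈ s.erase a, (α x + (β - Finsupp.single a 1 : Θ →₀ ℕ) x).choose (α x) =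
      ∏ x ∈ s.erase a, (α x + β x).choose (α x) := Finset.prod_congr rfl fun x hx => by
    have : a ≠ x := (Finset.ne_of_mem_erase hx).symm
    simp [this]
  have e2 : ∏ x ∈ s.erase a, ((α - Finsupp.single a 1 : Θ →₀ ℕ) x + β x).choose
      ((α - Finsupp.single a 1 : Θ →₀ ℕ) x) =
      ∏ x ∈ s.erase a, (α x + β x).choose (α x) := Finset.prod_congr rfl fun x hx => by
    have : a ≠ x := (Finset.ne_of_mem_erase hx).symm
    simp [this]
  rw [e1, e2, ← add_mul]
  congr 1
  obtain ⟨i, hi⟩ := Nat.exists_eq_succ_of_ne_zero hα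
  obtain ⟨j, hj⟩ := Nat.exists_eq_succ_of_ne_zero hβ
  simp only [hi, hj, Finsupp.coe_tsub, Pi.sub_apply, Finsupp.single_eq_same]
  have : i.succ + j.succ = (i + j + 1) + 1 := by omega
  rw [this, Nat.choose_succ_succ, show i.succ + (j.succ - 1) = i + j + 1 by omega,
    show i.succ - 1 + j.succ = i + j + 1 by omega, show i.succ - 1 = i by omega, add_comm]

theorem DP.coef_sub_right (α β : Θ →₀ ℕ) (a : Θ) (hα : α a = 0) :
    DP.coef α β = DP.coef α (β - Finsupp.single a 1) := by
  obtain ⟨s, hs⟩ := DP.exists_common α β 0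
  rw [DP.coef_eq α β s fun a ha => ⟨(hs a ha).1, (hs a ha).2.1⟩,
    DP.coef_eq α _ s fun a ha => by simp [hs a ha]]
  refine Finset.prod_congr rfl fun x _ => ?_
  by_cases hx : a = x
  · subst hx
    simp [hα]
  · simp [hx]

theorem DP.partialMap_mul [Fact p.Prime] [CharP K p] (a : Θ) (f g : DP p H K) :
    DP.partialMap p H K a (f * g) =
      f * DP.partialMap p H K a g + g * DP.partialMap p H K a f := by
  induction f using DP.induction with
  | h0 => simp
  | hadd x y hx hy => simp only [map_add, mul_add, add_mul, hx, hy]; abel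
  | hmono c α =>
    induction g using DP.induction with
    | h0 => simp
    | hadd x y hx hy => simp only [map_add, mul_add, add_mul, hx, hy]; abel
    | hmono d β =>
      simp only [map_smul, smul_mul_assoc, mul_smul_comm]
      rw [smul_comm d c, smul_comm d c, ← smul_add, ← smul_add]
      congr 2
      rw [DP.mono_mul_mono, DP.partialMap_coef, DP.partialMap_mono, DP.partialMap_mono]
      by_cases hα : α.1 a = 0
      · by_cases hβ : β.1 a = 0
        · simp [hα, hβ]
        · have e := DP.sub_add_single hβ
          have e' : α.1 + β.1 - Finsupp.single a 1 = α.1 + (β.1 - Finsupp.single a 1) := by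
            conv_lhs => rw [← e, ← add_assoc, add_tsub_cancel_right]
          simp only [Finsupp.add_apply, hα, hβ, zero_add, if_true, if_false, mul_zero, add_zero]
          rw [DP.mono_mul_mono, e', DP.coef_sub_right _ _ a hα]
      · have e1 := DP.sub_add_single hα
        have e1' : α.1 + β.1 - Finsupp.single a 1 = β.1 + (α.1 - Finsupp.single a 1) := by
          conv_lhs => rw [← e1, add_comm, ← add_assoc, add_tsub_cancel_right]
        by_cases hβ : β.1 a = 0
        · simp only [Finsupp.add_apply, hα, hβ, add_zero, if_true, if_false, mul_zero, zero_add]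
          rw [DP.mono_mul_mono, e1', DP.coef_comm, DP.coef_sub_right _ _ a hβ]
        · have e := DP.sub_add_single hβ
          have e' : α.1 + (β.1 - Finsupp.single a 1) = β.1 + (α.1 - Finsupp.single a 1) := by
            rw [← e1', ← add_tsub_cancel_right (α.1 + (β.1 - Finsupp.single a 1))
              (Finsupp.single a 1), add_assoc, e]
          have h0 : ¬ (α.1 + β.1) a = 0 := by simp [hα]
          rw [if_neg hα, if_neg hβ, if_neg h0, DP.mono_mul_mono, DP.mono_mul_mono, e1', e',
            ← add_smul, DP.coef_pascal α.1 β.1 a hα hβ, DP.coef_comm (α.1 - _)]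
          push_cast
          rfl

variable (p H K) in
/-- The derivation `∂_a` of the divided power algebra. -/
def DP.pd [Fact p.Prime] [CharP K p] (a : Θ) : Derivation K (DP p H K) (DP p H K) :=
  Derivation.mk' (DP.partialMap p H K a) (DP.partialMap_mul a)

end DividedPowers

/-- The sum of a family of derivations such that every element is killed by all but
finitely many of them. -/
def Derivation.locSum {K R : Type*} [Field K] [CommRing R] [Algebra K R]
    (D : ℕ → Derivation K R R) (h : ∀ f, {j | D j f ≠ 0}.Finite) : Derivation K R R :=
  Derivation.mk'
    { toFun := fun f => ∑ᶠ j, D j f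
      map_add' := fun f g => by
        simp only [map_add]
        exact finsum_add_distrib (h f) (h g)
      map_smul' := fun c f => by
        simp only [map_smul, RingHom.id_apply]
        exact (smul_finsum' c (h f)).symm }
    fun f g => by
      change ∑ᶠ j, D j (f * g) = f * ∑ᶠ j, D j g + g * ∑ᶠ j, D j f
      have hf : (Function.support fun j => g * D j f).Finite :=
        (h f).subset fun j hj h0 => hj (by simp [h0])
      have hg : (Function.support fun j => f * D j g).Finite :=
        (h g).subset fun j hj h0 => hj (by simp [h0])
      simp only [Derivation.leibniz, smul_eq_mul]
      rw [finsum_add_distrib hg hf, mul_finsum' _ _ (h f), mul_finsum' _ _ (h g)]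

theorem DP.pd_finite {Θ : Type*} (p : ℕ) (H : Θ → ℕ) (K : Type*) [Field K]
    [Fact p.Prime] [CharP K p] (f : DP p H K) : {a | DP.pd p H K a f ≠ 0}.Finite := by
  induction f using DP.induction with
  | h0 => simp
  | hadd x y hx hy =>
    refine (hx.union hy).subset fun a ha => ?_
    by_contra h
    simp only [Set.mem_union, Set.mem_ofPred_eq, not_or, not_not] at h
    exact ha (by rw [map_add, h.1, h.2, add_zero])
  | hmono c α =>
    refine α.1.support.finite_toSet.subset fun a ha => ?_
    simp only [Finset.mem_coe, Finsupp.mem_support_iff]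
    intro h0
    refine ha ?_
    change DP.partialMap p H K a _ = 0
    rw [map_smul, DP.partialMap_mono, if_pos h0, smul_zero]

/-! ### Restricted Lie algebras inside associative algebras -/

/-- A restricted Lie subalgebra of `A^{(-)}`, where `A` is an associative `K`-algebra and
`char K = p`: a subspace closed under `[a, b] = a b - b a` and `a ↦ a ^ p`. -/
structure RestrictedLieSubalgebra (K : Type*) [Field K] (p : ℕ) (A : Type*) [Ring A]
    [Algebra K A] extends LieSubalgebra K A where
  pow_mem' : ∀ a ∈ carrier, a ^ p ∈ carrier

namespace RestrictedLieSubalgebra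

variable {K : Type*} [Field K] {p : ℕ} {A : Type*} [Ring A] [Algebra K A]

/-- The `p`-mapping `x ↦ x^{[p]}`. -/
def pMap (L : RestrictedLieSubalgebra K p A) (x : L.toLieSubalgebra) : L.toLieSubalgebra :=
  ⟨x.1 ^ p, L.pow_mem' x.1 x.2⟩

variable (K p) in
/-- `Lie_p(X)`: the restricted Lie subalgebra generated by `X`. -/
def lieSpan (X : Set A) : RestrictedLieSubalgebra K p A where
  toLieSubalgebra := sInf {L : LieSubalgebra K A | X ⊆ L ∧ ∀ a ∈ L, a ^ p ∈ L}
  pow_mem' a ha := by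
    change a ^ p ∈ sInf {L : LieSubalgebra K A | X ⊆ L ∧ ∀ a ∈ L, a ^ p ∈ L}
    replace ha : a ∈ sInf {L : LieSubalgebra K A | X ⊆ L ∧ ∀ a ∈ L, a ^ p ∈ L} := ha
    rw [← SetLike.mem_coe, LieSubalgebra.coe_sInf, Set.mem_iInter₂] at ha ⊢
    exact fun L hL => hL.2 a (ha L hL)

end RestrictedLieSubalgebra

/-! ### Growth and the Gelfand–Kirillov dimension -/

section Growth

/-- The right-normed commutator `[x₁, …, x_s] = [x₁, [x₂, …, x_s]]`. -/
def rightNormed {L : Type*} [LieRing L] : List L → L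
  | [] => 0
  | [x] => x
  | x :: y :: l => ⁅x, rightNormed (y :: l)⁆

variable {K : Type*} [Field K] {p : ℕ} {A : Type*} [Ring A] [Algebra K A]

/-- `L^{(X,n)}`: the span of all `[x₁, …, x_s]^{[p^k]}` with `x_i ∈ X`, `s ≥ 1`, `s p^k ≤ n`. -/
def growthSpace (L : RestrictedLieSubalgebra K p A) (X : Set L.toLieSubalgebra) (n : ℕ) :
    Submodule K L.toLieSubalgebra :=
  Submodule.span K {a | ∃ (l : List L.toLieSubalgebra) (k : ℕ), l ≠ [] ∧ (∀ x ∈ l, x ∈ X) ∧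
    l.length * p ^ k ≤ n ∧ a = L.pMap^[k] (rightNormed l)}

/-- The growth function `γ_L(X, n) = dim L^{(X,n)}`. -/
def growth (L : RestrictedLieSubalgebra K p A) (X : Set L.toLieSubalgebra) (n : ℕ) : ℕ :=
  Module.finrank K (growthSpace L X n)

/-- The (upper) Gelfand–Kirillov dimension `limsup ln γ_L(X, n) / ln n` of a restricted Lie
algebra `L`, computed with its finite generating set `X`. -/
def gkDim (L : RestrictedLieSubalgebra K p A) (X : Set L.toLieSubalgebra) : EReal :=
  limsup (fun n : ℕ => ((Real.log (growth L X n) / Real.log n : ℝ) : EReal)) atTop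

end Growth

/-! ### Clover restricted Lie algebras -/

/-- The variables `x_n, y_n, z_n`, `n ≥ 0`. -/
inductive CloverVar : Type
  | x (n : ℕ)
  | y (n : ℕ)
  | z (n : ℕ)

namespace Clover

variable (p : ℕ) (K : Type*) [Field K] (S R : ℕ → ℕ)

/-- The heights: `x_i` has exponents below `p ^ S i`, while `y_i`, `z_i` have exponents
below `p ^ R i`. -/
def height : CloverVar → ℕ
  | .x n => S n
  | .y n => R n
  | .z n => R n

/-- The divided power algebra `R(Ξ)` of the tuple `Ξ = (S_n, R_n)`. -/
abbrev Alg : Type _ := DP p (height S R) K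

/-- The top divided power `t^{(p ^ h - 1)}` of a variable `t` of height `h`. -/
def top (t : CloverVar) : Alg p K S R :=
  DP.mono p (height S R) K (Finsupp.single t (p ^ height S R t - 1))

variable [Fact p.Prime] [CharP K p]

theorem locFinite (t : ℕ → CloverVar) (ht : Function.Injective t) (i : ℕ)
    (c : ℕ → Alg p K S R) (f : Alg p K S R) :
    {j | ((c j) • DP.pd p (height S R) K (t (i + j))) f ≠ 0}.Finite := by
  have h1 : Function.Injective fun j => t (i + j) := ht.comp (add_right_injective i)
  refine ((DP.pd_finite p (height S R) K f).preimage h1.injOn).subset fun j hj h0 => ?_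
  exact hj (by rw [Derivation.smul_apply, h0, smul_zero])

/-- The derivation `∂_{t_i} + m_i (∂_{t_{i+1}} + m_{i+1} (∂_{t_{i+2}} + m_{i+2} (⋯)))`. -/
def tower (t : ℕ → CloverVar) (ht : Function.Injective t) (m : ℕ → Alg p K S R) (i : ℕ) :
    Derivation K (Alg p K S R) (Alg p K S R) :=
  Derivation.locSum
    (fun j => (∏ k ∈ Finset.Ico i (i + j), m k) • DP.pd p (height S R) K (t (i + j)))
    (locFinite p K S R t ht i _)

/-- The defining recursion of the pivot elements. -/
theorem tower_eq (t : ℕ → CloverVar) (ht : Function.Injective t) (m : ℕ → Alg p K S R) (i : ℕ) :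
    tower p K S R t ht m i =
      DP.pd p (height S R) K (t i) + m i • tower p K S R t ht m (i + 1) := by
  ext f
  let D : ℕ → ℕ → Derivation K (Alg p K S R) (Alg p K S R) := fun i j =>
    (∏ k ∈ Finset.Ico i (i + j), m k) • DP.pd p (height S R) K (t (i + j))
  change ∑ᶠ j, D i j f = DP.pd p (height S R) K (t i) f + m i * ∑ᶠ j, D (i + 1) j f
  have hD : ∀ i j, D i (j + 1) f = m i * D (i + 1) j f := fun i j => by
    simp only [D, Derivation.smul_apply, smul_eq_mul]
    rw [Finset.prod_eq_prod_Ico_succ_bot (by omega), ← mul_assoc,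
      show i + (j + 1) = i + 1 + j by omega]
  have h0 : D i 0 f = DP.pd p (height S R) K (t i) f := by simp [D]
  have hf : (Function.support fun j => D i j f).Finite := locFinite p K S R t ht i _ f
  rw [mul_finsum' _ _ (locFinite p K S R t ht (i + 1) _ f), ← h0]
  obtain ⟨N, hN⟩ := hf.bddAbove
  have h1 : (Function.support fun j => D i j f) ⊆ (Finset.range (N + 2) : Set ℕ) := fun j hj => by
    have := hN hj
    simp only [Finset.coe_range, Set.mem_Iio]
    omega
  have h2 : (Function.support fun j => m i * D (i + 1) j f) ⊆
      (Finset.range (N + 1) : Set ℕ) := fun j hj => by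
    rw [Function.mem_support, ← hD] at hj
    have := hN hj
    simp only [Finset.coe_range, Set.mem_Iio]
    omega
  rw [finsum_eq_sum_of_support_subset _ h1, finsum_eq_sum_of_support_subset _ h2,
    Finset.sum_range_succ', add_comm]
  simp only [hD]

/-- `v_i = ∂_{x_i} + x_i^{(p^{S_i} - 1)} y_i^{(p^{R_i} - 1)} v_{i+1}`. -/
def v : ℕ → Derivation K (Alg p K S R) (Alg p K S R) :=
  tower p K S R .x (fun _ _ h => CloverVar.x.inj h) fun k => top p K S R (.x k) * top p K S R (.y k)

/-- `w_i = ∂_{y_i} + y_i^{(p^{R_i} - 1)} x_i^{(p^{S_i} - 1)} w_{i+1}`. -/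
def w : ℕ → Derivation K (Alg p K S R) (Alg p K S R) :=
  tower p K S R .y (fun _ _ h => CloverVar.y.inj h) fun k => top p K S R (.y k) * top p K S R (.x k)

/-- `u_i = ∂_{z_i} + z_i^{(p^{R_i} - 1)} x_i^{(p^{S_i} - 1)} u_{i+1}`. -/
def u : ℕ → Derivation K (Alg p K S R) (Alg p K S R) :=
  tower p K S R .z (fun _ _ h => CloverVar.z.inj h) fun k => top p K S R (.z k) * top p K S R (.x k)

/-- The set `{v_0, w_0, u_0}`, in `End_K R(Ξ)`. -/
def gens : Set (Module.End K (Alg p K S R)) :=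
  {(v p K S R 0).toLinearMap, (w p K S R 0).toLinearMap, (u p K S R 0).toLinearMap}

/-- The clover restricted Lie algebra `T(Ξ) = Lie_p(v_0, w_0, u_0)`. The Lie bracket of
derivations is their commutator and the `p`-mapping is the `p`-th power, both in
`End_K R(Ξ)`. -/
def T : RestrictedLieSubalgebra K p (Module.End K (Alg p K S R)) :=
  RestrictedLieSubalgebra.lieSpan K p (gens p K S R)

/-- The generators `v_0, w_0, u_0`, as elements of `T(Ξ)`. -/
def genSet : Set (T p K S R).toLieSubalgebra := {a | a.1 ∈ gens p K S R}

/-- The Gelfand–Kirillov dimension of `T(S, R)`, the clover restricted Lie algebra of the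
constant tuple `S_i = S`, `R_i = R`. -/
def gkDimConst (s r : ℕ) : EReal :=
  gkDim (T p K (fun _ => s) (fun _ => r)) (genSet p K (fun _ => s) (fun _ => r))

end Clover

end

/-! ### Powers and commutators in characteristic `p` -/

section CharPLie

/-! Put N = p^S, M = p^R, q = N M² = p^(S+2R), μ = N + M - 1. The algebra is self-similar: q counts
the monomials in the variables of one level, and μ is the cost of producing the pivots of level i+1
from those of level i. Hence GKdim = ln q / ln μ, and the theorem reduces to elementary estimates of
this quotient.

Upper bound. Give ∂_t of level i weight 1, a variable of level i weight -1, and a pivot of level i+1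
weight μ. Both summands of v_i = ∂_x + x^(N-1) y^(M-1) v_{i+1} then have weight 1, and likewise for
w_i, u_i. The span of the operators ∂_t^(p^k) and (monomial)·(element of level i+1) of weight at
most n is compatible with commutators and p-th powers (`levelGen_lie`, `levelGen_pow`), so it
contains everything of degree at most n. A monomial has degree at most D = N + 2M - 3, so the
dimension in degree n is at most S + 2R plus q times the dimension in degree (n + D)/μ one level up.
Iterating gives `growth_le`: roughly log_μ n steps, each costing a factor q.

Lower bound. In the ideal generated by [v_i, u_i], ad(v_i)^N applied to u_i is the full top monomial
of level i times [v_{i+1}, u_{i+1}]. The generators of level i+1 have degree at most μ over level i,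
so the top monomial times an ideal element of degree m has degree at most μm - D. Lowering exponents
by v_i, w_i, u_i costs at most D, so all q monomials appear in degree μm (`IdealAt.mulMono`). After
k levels this yields q^k independent elements of degree at most 2μ^k (`le_growth`).

Finally μ ≤ q ≤ μ³ puts the quotient in [1,3]. If R/S → c ∈ [0,1] with R ≤ S → ∞, then ln μ is
asymptotic to S ln p and the quotient tends to 1 + 2c, which takes every value in [1,3]. -/

theorem charP_of_nontrivial_algebra (p : ℕ) (K : Type*) [Field K] [CharP K p] (B : Type*) [Ring B] [Algebra K B] [Nontrivial B] :
    CharP B p :=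
  charP_of_injective_algebraMap (FaithfulSMul.algebraMap_injective K B) p

theorem commute_mulLeft_mulRight (K : Type*) [Field K] {A : Type*} [Ring A] [Algebra K A]
    (a b : A) : Commute (LinearMap.mulLeft K a) (LinearMap.mulRight K b) := by
  ext c
  simp [mul_assoc]

variable {p : ℕ} [Fact p.Prime]

theorem CharP.cast_choose_prime_sub_one {A : Type*} [Ring A] [CharP A p] {j : ℕ} (hj : j < p) :
    (((p - 1).choose j : ℕ) : A) = (-1) ^ j := by
  have hp := (Fact.out : p.Prime)
  induction j with
  | zero => simp
  | succ j ih =>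
    have h1 : p.choose (j + 1) = (p - 1).choose j + (p - 1).choose (j + 1) := by
      conv_lhs => rw [← Nat.sub_add_cancel hp.one_le, Nat.choose_succ_succ]
    have h2 : ((p.choose (j + 1) : ℕ) : A) = 0 :=
      (CharP.cast_eq_zero_iff A p _).2 (hp.dvd_choose_self (by omega) hj)
    rw [h1, Nat.cast_add, ih (by omega)] at h2
    rw [pow_succ, mul_neg_one]
    exact (neg_eq_of_add_eq_zero_right h2).symm

/-- Modulo p the binomial coefficients of p - 1 are alternating signs, which cancel the signs of the
expansion. With x, y the left and right multiplications by one element, the right side is the sum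
arising when a p-th power is differentiated. -/
theorem Commute.sub_pow_prime_sub_one {A : Type*} [Ring A] [CharP A p] {x y : A}
    (h : Commute x y) :
    (x - y) ^ (p - 1) = ∑ j ∈ Finset.range p, x ^ j * y ^ (p - 1 - j) := by
  have hp := (Fact.out : p.Prime)
  rw [sub_eq_neg_add, (h.symm.neg_left).add_pow, Nat.sub_add_cancel hp.one_le,
    ← Finset.sum_range_reflect]
  refine Finset.sum_congr rfl fun j hj => ?_
  have hj := Finset.mem_range.1 hj
  rw [CharP.cast_choose_prime_sub_one (A := A) (p := p) (j := p - 1 - j) (by omega),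
    neg_pow, show p - 1 - (p - 1 - j) = j by omega,
    ((Commute.neg_one_left (y ^ (p - 1 - j))).pow_left _).eq, mul_assoc, mul_assoc,
    ← mul_assoc ((-1 : A) ^ _), ((Commute.neg_one_left (x ^ j)).pow_left _).eq, mul_assoc,
    ← mul_pow]
  · simp [(h.pow_pow _ _).eq]
  · exact Commute.refl _

variable (p) (K : Type*) [Field K] [CharP K p] {A : Type*} [Ring A] [Algebra K A]

/-- Left and right multiplication commute, so Frobenius is additive on their difference: ad(a)^(p^k)
= ad(a^(p^k)). -/
theorem mulLeft_sub_mulRight_pow_char_pow [Nontrivial A] (a b : A) (k : ℕ) :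
    ((LinearMap.mulLeft K a - LinearMap.mulRight K a) ^ p ^ k) b =
      a ^ p ^ k * b - b * a ^ p ^ k := by
  have := charP_of_nontrivial_algebra p K (Module.End K A)
  rw [sub_pow_char_pow_of_commute p k (commute_mulLeft_mulRight K a a), LinearMap.pow_mulLeft,
    LinearMap.pow_mulRight]
  simp

theorem mulLeft_sub_mulRight_pow_prime_sub_one [Nontrivial A] (a b : A) :
    ((LinearMap.mulLeft K a - LinearMap.mulRight K a) ^ (p - 1)) b =
      ∑ j ∈ Finset.range p, a ^ j * b * a ^ (p - 1 - j) := by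
  have := charP_of_nontrivial_algebra p K (Module.End K A)
  rw [Commute.sub_pow_prime_sub_one (p := p) (commute_mulLeft_mulRight K a a)]
  simp [LinearMap.pow_mulLeft, LinearMap.pow_mulRight, LinearMap.sum_apply, mul_assoc]

open Polynomial in
theorem Polynomial.derivative_pow_eq_sum (P : A[X]) (n : ℕ) :
    derivative (P ^ n) = ∑ j ∈ Finset.range n, P ^ j * derivative P * P ^ (n - 1 - j) := by
  induction n with
  | zero => simp
  | succ n ih =>
    rw [pow_succ, derivative_mul, ih, Finset.sum_range_succ, Finset.sum_mul]
    congr 1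
    · refine Finset.sum_congr rfl fun j hj => ?_
      have := Finset.mem_range.1 hj
      rw [mul_assoc, ← pow_succ, show n - 1 - j + 1 = n + 1 - 1 - j by omega]
    · simp

variable {p K}

open Polynomial in
/-- A weak form of Jacobson's formula: modulo commutators of length `p`, taking `p`-th powers
is additive. -/
theorem add_pow_char_sub_mem_of_lie_mem [Nontrivial A] {G : ℕ → Submodule K A}
    (hG : ∀ m n, ∀ a ∈ G m, ∀ b ∈ G n, a * b - b * a ∈ G (m + n))
    {n : ℕ} {a b : A} (ha : a ∈ G n) (hb : b ∈ G n) :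
    (a + b) ^ p - a ^ p - b ^ p ∈ G (p * n) := by
  have hp := (Fact.out : p.Prime)
  -- Jacobson's argument: P^p has derivative ad(P)^(p-1)(a), whose coefficients are sums of
  -- commutators of length p in a and b. Integrating controls the middle coefficients of P^p; its
  -- extreme ones are a^p and b^p, and X = 1 gives (a + b)^p.
  set P : A[X] := C a * X + C b with hP
  have hder : derivative P = C a := by simp [hP]
  have hcoef (Q : A[X]) (i : ℕ) : (P * Q - Q * P).coeff i =
      (if i = 0 then 0 else a * Q.coeff (i - 1) - Q.coeff (i - 1) * a) +
        (b * Q.coeff i - Q.coeff i * b) := by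
    have h1 : P * Q - Q * P = (C a * Q - Q * C a) * X + (C b * Q - Q * C b) := by
      rw [hP, add_mul, mul_add, mul_assoc, X_mul, sub_mul, mul_assoc, mul_assoc]
      abel
    rw [h1]
    cases i <;> simp
  have had (j : ℕ) : ∀ i, (((LinearMap.mulLeft K P - LinearMap.mulRight K P) ^ j) (C a)).coeff i ∈
      G ((j + 1) * n) := by
    induction j with
    | zero =>
      intro i
      rw [pow_zero, Module.End.one_apply, coeff_C, zero_add, one_mul]
      split_ifs
      exacts [ha, zero_mem _]
    | succ j ih =>
      intro i
      rw [pow_succ', Module.End.mul_apply]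
      set Q := ((LinearMap.mulLeft K P - LinearMap.mulRight K P) ^ j) (C a)
      change (P * Q - Q * P).coeff i ∈ _
      rw [hcoef, show (j + 1 + 1) * n = n + (j + 1) * n by ring]
      refine add_mem ?_ (hG _ _ _ hb _ (ih i))
      split_ifs
      exacts [zero_mem _, hG _ _ _ ha _ (ih _)]
  have hmid (i : ℕ) (hi : i + 1 < p) : (P ^ p).coeff (i + 1) ∈ G (p * n) := by
    have h1 : (derivative (P ^ p)).coeff i ∈ G (p * n) := by
      rw [Polynomial.derivative_pow_eq_sum, hder,
        ← mulLeft_sub_mulRight_pow_prime_sub_one p K P (C a)]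
      have := had (p - 1) i
      rwa [Nat.sub_add_cancel hp.one_le] at this
    rw [coeff_derivative] at h1
    have h2 : (P ^ p).coeff (i + 1) * ((i : A) + 1) =
        ((i + 1 : ℕ) : K) • (P ^ p).coeff (i + 1) := by
      rw [Nat.cast_smul_eq_nsmul, nsmul_eq_mul, ← Nat.cast_succ]
      exact (Nat.cast_commute _ _).eq.symm
    rw [h2] at h1
    -- The factor produced by differentiation is invertible exactly because 0 < i + 1 < p; this
    -- leaves out only the two extreme coefficients.
    have h3 : ((i + 1 : ℕ) : K) ≠ 0 := fun h =>
      absurd (Nat.le_of_dvd (by omega) ((CharP.cast_eq_zero_iff K p _).1 h)) (by omega)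
    exact (Submodule.smul_mem_iff _ h3).1 h1
  have hdeg : P.natDegree ≤ 1 := natDegree_linear_le
  have htop : (P ^ p).coeff p = a ^ p := by
    have := coeff_pow_of_natDegree_le hdeg (m := p)
    simpa [hP] using this
  have hbot : (P ^ p).coeff 0 = b ^ p := by
    change constantCoeff (P ^ p) = _
    rw [map_pow]
    simp [hP]
  let ev : A[X] →+* A := eval₂RingHom' (RingHom.id A) 1 fun a => Commute.one_right a
  have hev : (a + b) ^ p = ∑ i ∈ Finset.range (p + 1), (P ^ p).coeff i := by
    have h1 : ev P = a + b := by
      change eval₂ (RingHom.id A) 1 P = a + b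
      simp [hP]
    rw [← h1, ← map_pow]
    change eval₂ (RingHom.id A) 1 (P ^ p) = _
    rw [eval₂_eq_sum_range' (n := p + 1)]
    · simp
    · have := natDegree_pow_le (p := P) (n := p)
      nlinarith
  rw [hev, Finset.sum_range_succ, htop, ← Nat.sub_add_cancel hp.one_le, Finset.sum_range_succ',
    Nat.sub_add_cancel hp.one_le, hbot]
  simp only [add_sub_cancel_right]
  exact sum_mem fun i hi => hmid i (by have := Finset.mem_range.1 hi; omega)

end CharPLie

/-! ### Filtrations generated by a set -/

section Reach

variable (K : Type*) [Field K] (p : ℕ) {A : Type*} [Ring A] [Algebra K A]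

/-- `LieReach K p X n a`: the element `a` of the restricted Lie algebra generated by `X`
has degree at most `n` in the generators. -/
inductive LieReach (X : Set A) : ℕ → A → Prop
  | gen {x : A} (hx : x ∈ X) : LieReach X 1 x
  | zero (n : ℕ) : LieReach X n 0
  | add {n : ℕ} {a b : A} (ha : LieReach X n a) (hb : LieReach X n b) : LieReach X n (a + b)
  | smul {n : ℕ} (c : K) {a : A} (ha : LieReach X n a) : LieReach X n (c • a)
  | lie {m n : ℕ} {a b : A} (ha : LieReach X m a) (hb : LieReach X n b) :
      LieReach X (m + n) (a * b - b * a)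
  | pow {n : ℕ} {a : A} (ha : LieReach X n a) : LieReach X (p * n) (a ^ p)
  | mono {m n : ℕ} (hmn : m ≤ n) {a : A} (ha : LieReach X m a) : LieReach X n a

variable {K p} {X : Set A}

theorem LieReach.mem_subalgebra {Z : Subalgebra K A} (hX : X ⊆ Z) {n : ℕ} {a : A}
    (h : LieReach K p X n a) : a ∈ Z := by
  induction h with
  | gen hx => exact hX hx
  | zero n => exact zero_mem _
  | add _ _ ha hb => exact add_mem ha hb
  | smul c _ ha => exact Subalgebra.smul_mem _ ha c
  | lie _ _ ha hb => exact sub_mem (mul_mem ha hb) (mul_mem hb ha)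
  | pow _ ha => exact pow_mem ha _
  | mono _ _ ha => exact ha

/-- Commutators and p-th powers of nonzero elements have degree at least 2. This starts the
recursion for the upper bound. -/
theorem LieReach.low (hp : 1 < p) {n : ℕ} {a : A} (h : LieReach K p X n a) :
    (n = 0 → a = 0) ∧ (n = 1 → a ∈ Submodule.span K X) := by
  induction h with
  | gen hx => exact ⟨by simp, fun _ => Submodule.subset_span hx⟩
  | zero n => exact ⟨fun _ => rfl, fun _ => zero_mem _⟩
  | add _ _ ha hb =>
    exact ⟨fun h => by rw [ha.1 h, hb.1 h, add_zero], fun h => add_mem (ha.2 h) (hb.2 h)⟩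
  | smul c _ ha =>
    exact ⟨fun h => by rw [ha.1 h, smul_zero], fun h => Submodule.smul_mem _ c (ha.2 h)⟩
  | @lie m n a b _ _ ha hb =>
    have : m + n ≤ 1 → a * b - b * a = 0 := fun h => by
      by_cases hm : m = 0
      · simp [ha.1 hm]
      · simp [hb.1 (by omega)]
    exact ⟨fun h => this (by omega), fun h => this h.le ▸ zero_mem _⟩
  | @pow n a _ ha =>
    have : p * n ≤ 1 → a ^ p = 0 := fun h => by
      have hn : n = 0 := by
        by_contra h0
        have := Nat.one_le_iff_ne_zero.2 h0
        nlinarith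
      rw [ha.1 hn, zero_pow (by omega)]
    exact ⟨fun h => this (by omega), fun h => this h.le ▸ zero_mem _⟩
  | @mono m n hmn a _ ha =>
    refine ⟨fun h => ha.1 (by omega), fun h => ?_⟩
    by_cases hm : m = 0
    · exact ha.1 hm ▸ zero_mem _
    · exact ha.2 (by omega)

theorem LieReach.pow_iterate {n : ℕ} {a : A} (h : LieReach K p X n a) (k : ℕ) :
    LieReach K p X (p ^ k * n) (a ^ p ^ k) := by
  induction k with
  | zero => simpa using h
  | succ k ih =>
    have := ih.pow
    rwa [← pow_mul, ← mul_assoc, ← pow_succ', ← pow_succ] at this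

end Reach

/-! ### Monomials and partial derivatives as operators -/

section Operators

variable {Θ : Type*} {p : ℕ} {H : Θ → ℕ} {K : Type*} [Field K]

variable (p H K) in
/-- Multiplication by a monomial. -/
noncomputable def DP.mulMono (α : Θ →₀ ℕ) : Module.End K (DP p H K) := LinearMap.mulLeft K (DP.mono p H K α)

theorem DP.mulMono_eq_zero {α : Θ →₀ ℕ} (h : ¬ ∀ a, α a < p ^ H a) : DP.mulMono p H K α = 0 := by
  rw [DP.mulMono, DP.mono_eq_zero h, LinearMap.mulLeft_zero_eq_zero]

theorem DP.mulMono_mul_mulMono (α β : Θ →₀ ℕ) :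
    DP.mulMono p H K α * DP.mulMono p H K β = (DP.coef α β : K) • DP.mulMono p H K (α + β) := by
  ext1 f
  simp [DP.mulMono, ← mul_assoc, DP.mono_mul_mono]

theorem DP.mulMono_zero : DP.mulMono p H K 0 = 1 := by
  ext1 f
  simp [DP.mulMono, ← DP.one_def]

theorem DP.mulMono_commute (α β : Θ →₀ ℕ) :
    Commute (DP.mulMono p H K α) (DP.mulMono p H K β) := by
  ext1 f
  simp [DP.mulMono, mul_left_comm]

theorem DP.partialMap_commute (a b : Θ) :
    Commute (DP.partialMap p H K a) (DP.partialMap p H K b) := by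
  refine DP.hom_ext fun α => ?_
  have key (a b : Θ) : DP.partialMap p H K a (DP.partialMap p H K b (DP.mono p H K α.1)) =
      if α.1 b = 0 ∨ (α.1 - Finsupp.single b 1 : Θ →₀ ℕ) a = 0 then 0 else
        DP.mono p H K (α.1 - Finsupp.single b 1 - Finsupp.single a 1) := by
    rw [DP.partialMap_mono]
    by_cases hb : α.1 b = 0
    · simp [hb]
    · rw [if_neg hb]
      exact (DP.partialMap_mono (K := K) a (⟨α.1 - Finsupp.single b 1, fun c =>
        lt_of_le_of_lt (by simp) (α.2 c)⟩ : DPExp p H)).trans (if_congr (by simp [hb]) rfl rfl)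
  rw [Module.End.mul_apply, Module.End.mul_apply, key, key, tsub_right_comm]
  by_cases h : a = b
  · subst h
    rfl
  · have h' : b ≠ a := fun e => h e.symm
    simp [h, h', or_comm]

theorem DP.partialMap_pow_mono (a : Θ) (α : DPExp p H) (j : ℕ) :
    (DP.partialMap p H K a ^ j) (DP.mono p H K α.1) =
      if α.1 a < j then 0 else DP.mono p H K (α.1 - Finsupp.single a j) := by
  induction j with
  | zero => simp
  | succ j ih =>
    rw [pow_succ', Module.End.mul_apply, ih]
    by_cases h : α.1 a < j
    · rw [if_pos h, if_pos (by omega), map_zero]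
    · rw [if_neg h]
      have := DP.partialMap_mono (K := K) a (⟨α.1 - Finsupp.single a j, fun c =>
        lt_of_le_of_lt (by simp) (α.2 c)⟩ : DPExp p H)
      refine Eq.trans this ?_
      have e : α.1 - Finsupp.single a j - Finsupp.single a 1 =
          α.1 - Finsupp.single a (j + 1) := by
        rw [tsub_tsub, ← Finsupp.single_add]
      rw [e]
      refine if_congr ?_ rfl rfl
      simp
      omega

theorem DP.partialMap_pow_eq_zero (a : Θ) {j : ℕ} (hj : p ^ H a ≤ j) :
    DP.partialMap p H K a ^ j = 0 := DP.hom_ext fun α => by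
  rw [DP.partialMap_pow_mono, if_pos ((α.2 a).trans_le hj), LinearMap.zero_apply]

variable [Fact p.Prime]

theorem DP.nontrivial : Nontrivial (DP p H K) := by
  refine ⟨⟨1, 0, fun h => ?_⟩⟩
  have h0 : ∀ a, (0 : Θ →₀ ℕ) a < p ^ H a := fun a => pow_pos (Fact.out : p.Prime).pos _
  have := (DP.basis p H K).ne_zero ⟨0, h0⟩
  rw [DP.basis_eq] at this
  exact this h

instance : Nontrivial (DP p H K) := DP.nontrivial

variable [CharP K p]

theorem DP.partialMap_mul_mulMono (a : Θ) (α : DPExp p H) :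
    DP.partialMap p H K a * DP.mulMono p H K α.1 -
      DP.mulMono p H K α.1 * DP.partialMap p H K a =
    if α.1 a = 0 then 0 else DP.mulMono p H K (α.1 - Finsupp.single a 1) := by
  ext1 f
  have h1 : DP.partialMap p H K a (DP.mono p H K α.1 * f) -
      DP.mono p H K α.1 * DP.partialMap p H K a f =
      DP.partialMap p H K a (DP.mono p H K α.1) * f := by
    rw [DP.partialMap_mul]
    ring
  change DP.partialMap p H K a (DP.mono p H K α.1 * f) -
      DP.mono p H K α.1 * DP.partialMap p H K a f = _
  rw [h1, DP.partialMap_mono]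
  split_ifs
  · simp
  · rfl

theorem DP.partialMap_sub_iterate_mulMono (a : Θ) (α : DPExp p H) (j : ℕ) :
    ((LinearMap.mulLeft K (DP.partialMap p H K a) - LinearMap.mulRight K (DP.partialMap p H K a))
      ^ j) (DP.mulMono p H K α.1) =
    if α.1 a < j then 0 else DP.mulMono p H K (α.1 - Finsupp.single a j) := by
  induction j with
  | zero => simp
  | succ j ih =>
    rw [pow_succ', Module.End.mul_apply, ih]
    by_cases h : α.1 a < j
    · rw [if_pos h, if_pos (by omega), map_zero]
    · rw [if_neg h]
      have := DP.partialMap_mul_mulMono (K := K) a (⟨α.1 - Finsupp.single a j, fun c =>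
        lt_of_le_of_lt (by simp) (α.2 c)⟩ : DPExp p H)
      refine Eq.trans this ?_
      have e : α.1 - Finsupp.single a j - Finsupp.single a 1 = α.1 - Finsupp.single a (j + 1) := by
        rw [tsub_tsub, ← Finsupp.single_add]
      rw [e]
      refine if_congr ?_ rfl rfl
      simp
      omega

/-- Since ad(∂)^(p^k) = ad(∂^(p^k)), the operator ∂^(p^k) is again a derivation and lowers an
exponent by p^k at once. -/
theorem DP.partialMap_pow_mul_mulMono (a : Θ) (α : DPExp p H) (k : ℕ) :
    DP.partialMap p H K a ^ p ^ k * DP.mulMono p H K α.1 -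
      DP.mulMono p H K α.1 * DP.partialMap p H K a ^ p ^ k =
    if α.1 a < p ^ k then 0 else DP.mulMono p H K (α.1 - Finsupp.single a (p ^ k)) := by
  rw [← mulLeft_sub_mulRight_pow_char_pow p K, DP.partialMap_sub_iterate_mulMono]

/-- The last multiplication contributes a factor binom(pa, a) for some exponent a > 0, and binom(pa,
a) = p · binom(pa - 1, a - 1). -/
theorem DP.mulMono_pow_char {α : Θ →₀ ℕ} (h : α ≠ 0) : DP.mulMono p H K α ^ p = 0 := by
  have hp := (Fact.out : p.Prime)
  have key (n : ℕ) : ∃ c : K, DP.mulMono p H K α ^ n = c • DP.mulMono p H K (n • α) := by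
    induction n with
    | zero => exact ⟨1, by simp [DP.mulMono_zero]⟩
    | succ n ih =>
      obtain ⟨c, hc⟩ := ih
      exact ⟨c * DP.coef (n • α) α, by
        rw [pow_succ, hc, smul_mul_assoc, DP.mulMono_mul_mulMono, smul_smul, succ_nsmul]⟩
  obtain ⟨c, hc⟩ := key (p - 1)
  have hdvd : p ∣ DP.coef ((p - 1) • α) α := by
    obtain ⟨a, ha⟩ := Finsupp.ne_iff.1 h
    obtain ⟨s, hs⟩ := DP.exists_common α 0 0
    rw [DP.coef_eq _ α s fun a ha => by simp [hs a ha]]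
    have hs : a ∈ s := by
      by_contra h0
      exact ha (by simpa using (hs a h0).1)
    refine dvd_trans ?_ (Finset.dvd_prod_of_mem _ hs)
    obtain ⟨m, hm⟩ := Nat.exists_eq_succ_of_ne_zero (show α a ≠ 0 from ha)
    have e : (p - 1) * α a + α a = p * α a := by
      rw [← Nat.succ_mul, Nat.succ_eq_add_one, Nat.sub_add_cancel hp.one_le]
    simp only [Finsupp.smul_apply, smul_eq_mul]
    rw [e, Nat.choose_symm_of_eq_add (b := α a) (by rw [e])]
    have h2 := Nat.add_one_mul_choose_eq (p * α a - 1) m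
    have h3 : 0 < p * α a := Nat.mul_pos hp.pos (by omega)
    rw [show p * α a - 1 + 1 = p * α a by omega, show m + 1 = α a from hm.symm] at h2
    refine ⟨(p * α a - 1).choose m, ?_⟩
    refine Nat.eq_of_mul_eq_mul_right (show 0 < α a by omega) ?_
    rw [← h2]
    ring
  have e : DP.mulMono p H K α ^ p = DP.mulMono p H K α ^ (p - 1) * DP.mulMono p H K α := by
    rw [← pow_succ, Nat.sub_add_cancel hp.one_le]
  rw [e, hc, smul_mul_assoc, DP.mulMono_mul_mulMono,
    (CharP.cast_eq_zero_iff K p _).2 hdvd, zero_smul, smul_zero]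

end Operators

/-! ### Splitting off the variables of one level -/

section LevelStep

variable {Θ : Type*} (p : ℕ) (H : Θ → ℕ) (K : Type*) [Field K] (B : Set Θ)

/-- The operators which commute with the multiplications by monomials in the variables of `B` and
with the partial derivatives with respect to these variables. -/
noncomputable def levelCentralizer : Subalgebra K (Module.End K (DP p H K)) :=
  Subalgebra.centralizer K ({f | ∃ α : Θ →₀ ℕ, (∀ t ∉ B, α t = 0) ∧ f = DP.mulMono p H K α} ∪
    {f | ∃ t ∈ B, f = DP.partialMap p H K t})

/-- Operators of degree at most `n` built from the variables of `B` and from the elements generated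
by a set `X'` of operators of degree `μ`. -/
def levelGen (X' : Set (Module.End K (DP p H K))) (μ n : ℕ) : Set (Module.End K (DP p H K)) :=
  {f | ∃ t ∈ B, ∃ k, p ^ k ≤ n ∧ f = DP.partialMap p H K t ^ p ^ k} ∪
  {f | ∃ (α : Θ →₀ ℕ) (m : ℕ) (g : Module.End K (DP p H K)), (∀ t ∉ B, α t = 0) ∧
    LieReach K p X' m g ∧ μ * m ≤ n + α.degree ∧ f = DP.mulMono p H K α * g}

variable {p H K B}

theorem levelCentralizer_commute_mulMono {g : Module.End K (DP p H K)}
    (hg : g ∈ levelCentralizer p H K B) {α : Θ →₀ ℕ} (hα : ∀ t ∉ B, α t = 0) :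
    Commute g (DP.mulMono p H K α) :=
  ((Subalgebra.mem_centralizer_iff K).1 hg _ (Or.inl ⟨α, hα, rfl⟩)).symm

theorem levelCentralizer_commute_partialMap {g : Module.End K (DP p H K)}
    (hg : g ∈ levelCentralizer p H K B) {t : Θ} (ht : t ∈ B) :
    Commute g (DP.partialMap p H K t) :=
  ((Subalgebra.mem_centralizer_iff K).1 hg _ (Or.inr ⟨t, ht, rfl⟩)).symm

theorem lie_mulMono_mul {α β : Θ →₀ ℕ} {g h : Module.End K (DP p H K)}
    (hg : Commute g (DP.mulMono p H K β)) (hh : Commute h (DP.mulMono p H K α)) :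
    DP.mulMono p H K α * g * (DP.mulMono p H K β * h) -
      DP.mulMono p H K β * h * (DP.mulMono p H K α * g) =
    DP.mulMono p H K α * DP.mulMono p H K β * (g * h - h * g) := by
  have e1 : DP.mulMono p H K α * g * (DP.mulMono p H K β * h) =
      DP.mulMono p H K α * DP.mulMono p H K β * (g * h) := by
    rw [mul_assoc, ← mul_assoc g, hg.eq, mul_assoc, mul_assoc]
  have e2 : DP.mulMono p H K β * h * (DP.mulMono p H K α * g) =
      DP.mulMono p H K α * DP.mulMono p H K β * (h * g) := by
    rw [mul_assoc, ← mul_assoc h, hh.eq, mul_assoc, ← mul_assoc,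
      (DP.mulMono_commute β α).eq]
  rw [e1, e2, mul_sub]

theorem lie_mul_of_commute {A : Type*} [Ring A] {d a g : A} (hg : Commute g d) :
    d * (a * g) - a * g * d = (d * a - a * d) * g := by
  rw [mul_assoc a g d, hg.eq, sub_mul, mul_assoc, mul_assoc]

variable {X' : Set (Module.End K (DP p H K))} {μ : ℕ}


theorem levelGen_mono {m n : ℕ} (h : m ≤ n) : levelGen p H K B X' μ m ⊆ levelGen p H K B X' μ n := by
  rintro f (⟨t, ht, k, hk, rfl⟩ | ⟨α, m', g, hα, hg, hm, rfl⟩)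
  · exact Or.inl ⟨t, ht, k, hk.trans h, rfl⟩
  · exact Or.inr ⟨α, m', g, hα, hg, by omega, rfl⟩

variable [Fact p.Prime] [CharP K p]

/-- The commutator lowers the degree of the monomial by p^k, so its weight rises by p^k, which is at
most l. -/
theorem levelGen_lie_partial (hX' : X' ⊆ levelCentralizer p H K B) {t : Θ} (ht : t ∈ B)
    {k n l : ℕ} (hkl : p ^ k ≤ l) {α : Θ →₀ ℕ} {m : ℕ} {g : Module.End K (DP p H K)}
    (hα : ∀ t ∉ B, α t = 0) (hg : LieReach K p X' m g) (hm : μ * m ≤ n + α.degree) :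
    DP.partialMap p H K t ^ p ^ k * (DP.mulMono p H K α * g) -
      DP.mulMono p H K α * g * DP.partialMap p H K t ^ p ^ k ∈
      Submodule.span K (levelGen p H K B X' μ (l + n)) := by
  rw [lie_mul_of_commute
    ((levelCentralizer_commute_partialMap (hg.mem_subalgebra hX') ht).pow_right _)]
  by_cases hr : ∀ a, α a < p ^ H a
  · have := DP.partialMap_pow_mul_mulMono (K := K) t ⟨α, hr⟩ k
    rw [this]
    split_ifs with h
    · rw [zero_mul]
      exact zero_mem _
    · refine Submodule.subset_span (Or.inr ⟨_, m, g, fun s hs => ?_, hg, ?_, rfl⟩)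
      · simp [hα s hs]
      · have h1 : α.degree = (α - Finsupp.single t (p ^ k)).degree + p ^ k := by
          conv_lhs => rw [← tsub_add_cancel_of_le
            (Finsupp.single_le_iff.2 (not_lt.1 h) : Finsupp.single t (p ^ k) ≤ α)]
          rw [map_add, Finsupp.degree_single]
        change μ * m ≤ l + n + (α - Finsupp.single t (p ^ k)).degree
        omega
  · rw [DP.mulMono_eq_zero hr]
    simp

/-- Weights add under commutators. For two terms of the form monomial times next-level element,
everything commutes except the next-level factors, so the bracket is the product of the monomials
times the bracket of those factors. -/
theorem levelGen_lie (hX' : X' ⊆ levelCentralizer p H K B) (m n : ℕ)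
    (a : Module.End K (DP p H K)) (ha : a ∈ Submodule.span K (levelGen p H K B X' μ m))
    (b : Module.End K (DP p H K)) (hb : b ∈ Submodule.span K (levelGen p H K B X' μ n)) :
    a * b - b * a ∈ Submodule.span K (levelGen p H K B X' μ (m + n)) := by
  induction ha using Submodule.span_induction with
  | zero => simp
  | add x y _ _ hx hy =>
    rw [add_mul, mul_add, add_sub_add_comm]
    exact add_mem hx hy
  | smul c x _ hx =>
    rw [smul_mul_assoc, mul_smul_comm, ← smul_sub]
    exact Submodule.smul_mem _ _ hx
  | mem x hx =>
  induction hb using Submodule.span_induction with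
  | zero => simp
  | add x y _ _ hx hy =>
    rw [add_mul, mul_add, add_sub_add_comm]
    exact add_mem hx hy
  | smul c x _ hx =>
    rw [smul_mul_assoc, mul_smul_comm, ← smul_sub]
    exact Submodule.smul_mem _ _ hx
  | mem y hy =>
  obtain ⟨t, ht, k, hk, rfl⟩ | ⟨α, m', g, hα, hg, hm, rfl⟩ := hx <;>
  obtain ⟨s, hs, l, hl, rfl⟩ | ⟨β, n', h, hβ, hh, hn, rfl⟩ := hy
  · rw [((DP.partialMap_commute t s).pow_pow _ _).eq, sub_self]
    exact zero_mem _
  · exact levelGen_lie_partial hX' ht hk hβ hh hn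
  · rw [← neg_sub, add_comm]
    exact neg_mem (levelGen_lie_partial hX' hs hl hα hg hm)
  · rw [lie_mulMono_mul (levelCentralizer_commute_mulMono (hg.mem_subalgebra hX') hβ)
      (levelCentralizer_commute_mulMono (hh.mem_subalgebra hX') hα), DP.mulMono_mul_mulMono,
      smul_mul_assoc]
    refine Submodule.smul_mem _ _ (Submodule.subset_span (Or.inr
      ⟨_, _, _, fun s hs => ?_, hg.lie hh, ?_, rfl⟩))
    · simp [hα s hs, hβ s hs]
    · rw [map_add]
      linarith

/-- Jacobson's formula reduces to the spanning operators. There (monomial · g)^p = monomial^p · g^p,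
which vanishes unless the monomial is 1, in which case it is the p-th power of a next-level element.
-/
theorem levelGen_pow (hX' : X' ⊆ levelCentralizer p H K B) (n : ℕ)
    (a : Module.End K (DP p H K)) (ha : a ∈ Submodule.span K (levelGen p H K B X' μ n)) :
    a ^ p ∈ Submodule.span K (levelGen p H K B X' μ (p * n)) := by
  have hp := (Fact.out : p.Prime)
  induction ha using Submodule.span_induction with
  | zero =>
    rw [zero_pow hp.ne_zero]
    exact zero_mem _
  | add x y hx' hy' hx hy =>
    have := add_pow_char_sub_mem_of_lie_mem (p := p)
      (G := fun n => Submodule.span K (levelGen p H K B X' μ n)) (levelGen_lie hX') hx' hy'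
    have := add_mem (add_mem this hy) hx
    simpa using this
  | smul c x _ hx =>
    rw [smul_pow]
    exact Submodule.smul_mem _ _ hx
  | mem x hx =>
    obtain ⟨t, ht, k, hk, rfl⟩ | ⟨α, m', g, hα, hg, hm, rfl⟩ := hx
    · refine Submodule.subset_span (Or.inl ⟨t, ht, k + 1, ?_, ?_⟩)
      · rw [pow_succ']
        exact Nat.mul_le_mul_left p hk
      · rw [← pow_mul, pow_succ]
    · rw [((levelCentralizer_commute_mulMono (hg.mem_subalgebra hX') hα).symm).mul_pow]
      by_cases h0 : α = 0
      · subst h0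
        refine Submodule.subset_span (Or.inr ⟨0, _, _, by simp, hg.pow, ?_, ?_⟩)
        · simp only [map_zero, add_zero] at hm ⊢
          calc μ * (p * m') = p * (μ * m') := by ring
            _ ≤ p * n := Nat.mul_le_mul_left p hm
        · rw [DP.mulMono_zero, one_pow]
      · rw [DP.mulMono_pow_char h0, zero_mul]
        exact zero_mem _

theorem LieReach.mem_span_levelGen {X : Set (Module.End K (DP p H K))}
    (hX' : X' ⊆ levelCentralizer p H K B)
    (hX : X ⊆ Submodule.span K (levelGen p H K B X' μ 1)) {n : ℕ} {a : Module.End K (DP p H K)}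
    (h : LieReach K p X n a) : a ∈ Submodule.span K (levelGen p H K B X' μ n) := by
  induction h with
  | gen hx => exact hX hx
  | zero n => exact zero_mem _
  | add _ _ ha hb => exact add_mem ha hb
  | smul c _ ha => exact Submodule.smul_mem _ c ha
  | lie _ _ ha hb => exact levelGen_lie hX' _ _ _ ha _ hb
  | pow _ ha => exact levelGen_pow hX' _ _ ha
  | mono h _ ha => exact Submodule.span_mono (levelGen_mono h) ha

end LevelStep

theorem DP.coef_eq_one {Θ : Type*} {α β : Θ →₀ ℕ} (h : ∀ a, α a = 0 ∨ β a = 0) :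
    DP.coef α β = 1 := by
  obtain ⟨s, hs⟩ := DP.exists_common α β 0
  rw [DP.coef_eq α β s fun a ha => ⟨(hs a ha).1, (hs a ha).2.1⟩]
  refine Finset.prod_eq_one fun a _ => ?_
  rcases h a with h | h <;> simp [h]

theorem DP.mono_mul_mono_of_disjoint {Θ : Type*} {p : ℕ} {H : Θ → ℕ} {K : Type*} [Field K]
    {α β : Θ →₀ ℕ} (h : ∀ a, α a = 0 ∨ β a = 0) :
    DP.mono p H K α * DP.mono p H K β = DP.mono p H K (α + β) := by
  rw [DP.mono_mul_mono, DP.coef_eq_one h, Nat.cast_one, one_smul]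

theorem DP.partialMap_mono_eq_zero {Θ : Type*} {p : ℕ} {H : Θ → ℕ} {K : Type*} [Field K]
    {α : Θ →₀ ℕ} {a : Θ} (h : α a = 0) : DP.partialMap p H K a (DP.mono p H K α) = 0 := by
  by_cases hr : ∀ a, α a < p ^ H a
  · rw [DP.partialMap_mono a ⟨α, hr⟩, if_pos h]
  · rw [DP.mono_eq_zero hr, map_zero]

/-! ### Pivot elements and their place relative to one level -/

namespace Clover

variable {p : ℕ} {K : Type*} [Field K] {S R : ℕ → ℕ}

/-- The variables of level `i`. -/
def level (i : ℕ) : Set CloverVar := {.x i, .y i, .z i}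

theorem top_mul_top {s t : CloverVar} (hst : s ≠ t) : top p K S R s * top p K S R t =
    DP.mono p (height S R) K (Finsupp.single s (p ^ height S R s - 1) +
      Finsupp.single t (p ^ height S R t - 1)) := by
  classical
  refine DP.mono_mul_mono_of_disjoint fun a => ?_
  simp only [Finsupp.single_apply]
  by_cases h : s = a
  · right
    rw [if_neg fun e => hst (h.trans e.symm)]
  · left
    rw [if_neg h]

theorem partialMap_top {s t : CloverVar} (hst : s ≠ t) :
    DP.partialMap p (height S R) K s (top p K S R t) = 0 :=
  DP.partialMap_mono_eq_zero (by simp [hst])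

variable (p S R) in
/-- The exponent of `x_i^{(p^{S_i} - 1)} y_i^{(p^{R_i} - 1)}`. -/
noncomputable def topXY (i : ℕ) : CloverVar →₀ ℕ :=
  Finsupp.single (.x i) (p ^ S i - 1) + Finsupp.single (.y i) (p ^ R i - 1)

variable (p S R) in
/-- The exponent of `x_i^{(p^{S_i} - 1)} z_i^{(p^{R_i} - 1)}`. -/
noncomputable def topXZ (i : ℕ) : CloverVar →₀ ℕ :=
  Finsupp.single (.x i) (p ^ S i - 1) + Finsupp.single (.z i) (p ^ R i - 1)

theorem topXY_eq_zero {i : ℕ} {t : CloverVar} (ht : t ∉ level i) : topXY p S R i t = 0 := by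
  simp only [level, Set.mem_insert_iff, Set.mem_singleton_iff, not_or] at ht
  simp [topXY, ht]

theorem topXZ_eq_zero {i : ℕ} {t : CloverVar} (ht : t ∉ level i) : topXZ p S R i t = 0 := by
  simp only [level, Set.mem_insert_iff, Set.mem_singleton_iff, not_or] at ht
  simp [topXZ, ht]

section Tower

variable [Fact p.Prime] [CharP K p]

theorem tower_apply (t : ℕ → CloverVar) (ht : Function.Injective t) (m : ℕ → Alg p K S R) (i : ℕ)
    (f : Alg p K S R) : tower p K S R t ht m i f =
      ∑ᶠ j, (∏ k ∈ Finset.Ico i (i + j), m k) * DP.partialMap p (height S R) K (t (i + j)) f := rfl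

/-- Such a tower differentiates only in variables outside B, and its coefficients are constants for
the derivations in the variables of B. -/
theorem tower_mem_levelCentralizer {B : Set CloverVar} {t : ℕ → CloverVar}
    (ht : Function.Injective t) {m : ℕ → Alg p K S R} {i : ℕ} (hB : ∀ j, i ≤ j → t j ∉ B)
    (hm : ∀ s ∈ B, ∀ j, i ≤ j → DP.partialMap p (height S R) K s (m j) = 0) :
    (tower p K S R t ht m i).toLinearMap ∈ levelCentralizer p (height S R) K B := by
  refine (Subalgebra.mem_centralizer_iff K).2 ?_
  rintro _ (⟨α, hα, rfl⟩ | ⟨s, hs, rfl⟩)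
  · ext1 f
    change DP.mono p _ K α * tower p K S R t ht m i f = tower p K S R t ht m i (_ * f)
    have h0 : tower p K S R t ht m i (DP.mono p _ K α) = 0 := by
      rw [tower_apply, finsum_eq_zero_of_forall_eq_zero]
      intro j
      rw [DP.partialMap_mono_eq_zero (hα _ (hB _ (Nat.le_add_right _ _))), mul_zero]
    rw [Derivation.leibniz, h0, smul_zero, add_zero, smul_eq_mul]
  · ext1 f
    change DP.partialMap p _ K s (tower p K S R t ht m i f) = tower p K S R t ht m i _
    rw [tower_apply, tower_apply]
    have := (DP.partialMap p (height S R) K s).toAddMonoidHom.map_finsum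
      (locFinite p K S R t ht i (fun j => ∏ k ∈ Finset.Ico i (i + j), m k) f)
    refine this.trans (finsum_congr fun j => ?_)
    have hprod : DP.partialMap p (height S R) K s (∏ k ∈ Finset.Ico i (i + j), m k) = 0 := by
      refine Finset.prod_induction _ (fun g => DP.partialMap p (height S R) K s g = 0)
        (fun a b ha hb => ?_) ?_ fun k hk => hm s hs k (Finset.mem_Ico.1 hk).1
      · rw [DP.partialMap_mul, ha, hb, mul_zero, mul_zero, add_zero]
      · exact DP.partialMap_mono_eq_zero rfl
    change DP.partialMap p (height S R) K s
      ((∏ k ∈ Finset.Ico i (i + j), m k) * DP.partialMap p (height S R) K (t (i + j)) f) = _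
    rw [DP.partialMap_mul, hprod, mul_zero, add_zero]
    congr 1
    exact congrArg (fun F => F f) (DP.partialMap_commute (K := K) s (t (i + j))).eq

variable (p K S R) in
/-- `v_i` as a linear operator. -/
noncomputable def vEnd (i : ℕ) : Module.End K (Alg p K S R) := (v p K S R i).toLinearMap

variable (p K S R) in
/-- `w_i` as a linear operator. -/
noncomputable def wEnd (i : ℕ) : Module.End K (Alg p K S R) := (w p K S R i).toLinearMap

variable (p K S R) in
/-- `u_i` as a linear operator. -/
noncomputable def uEnd (i : ℕ) : Module.End K (Alg p K S R) := (u p K S R i).toLinearMap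

variable (p K S R) in
/-- The pivot elements of level `i`. -/
def gensAt (i : ℕ) : Set (Module.End K (Alg p K S R)) :=
  {vEnd p K S R i, wEnd p K S R i, uEnd p K S R i}

theorem vEnd_mem {i j : ℕ} (h : i < j) :
    vEnd p K S R j ∈ levelCentralizer p (height S R) K (level i) := by
  refine tower_mem_levelCentralizer _ (fun k hk => ?_) fun s hs k hk => ?_
  · rintro (h | h | h) <;> (cases h; try omega)
  · have hki : i ≠ k := by omega
    rw [DP.partialMap_mul, partialMap_top, partialMap_top]
    · simp
    all_goals
      rcases hs with rfl | rfl | rfl <;> simp [hki]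

theorem wEnd_mem {i j : ℕ} (h : i < j) :
    wEnd p K S R j ∈ levelCentralizer p (height S R) K (level i) := by
  refine tower_mem_levelCentralizer _ (fun k hk => ?_) fun s hs k hk => ?_
  · rintro (h | h | h) <;> (cases h; try omega)
  · have hki : i ≠ k := by omega
    rw [DP.partialMap_mul, partialMap_top, partialMap_top]
    · simp
    all_goals
      rcases hs with rfl | rfl | rfl <;> simp [hki]

theorem uEnd_mem {i j : ℕ} (h : i < j) :
    uEnd p K S R j ∈ levelCentralizer p (height S R) K (level i) := by
  refine tower_mem_levelCentralizer _ (fun k hk => ?_) fun s hs k hk => ?_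
  · rintro (h | h | h) <;> (cases h; try omega)
  · have hki : i ≠ k := by omega
    rw [DP.partialMap_mul, partialMap_top, partialMap_top]
    · simp
    all_goals
      rcases hs with rfl | rfl | rfl <;> simp [hki]

theorem gensAt_subset {i j : ℕ} (h : i < j) :
    gensAt p K S R j ⊆ levelCentralizer p (height S R) K (level i) := by
  rintro _ (rfl | rfl | rfl)
  exacts [vEnd_mem h, wEnd_mem h, uEnd_mem h]

theorem vEnd_eq (i : ℕ) : vEnd p K S R i = DP.partialMap p (height S R) K (.x i) +
    DP.mulMono p (height S R) K (topXY p S R i) * vEnd p K S R (i + 1) := by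
  ext1 f
  have := congrArg (fun D => D f) (tower_eq p K S R .x (fun _ _ h => CloverVar.x.inj h)
    (fun k => top p K S R (.x k) * top p K S R (.y k)) i)
  refine Eq.trans this ?_
  change _ + _ * _ = _ + DP.mono _ _ _ _ * _
  rw [top_mul_top (by simp)]
  rfl

theorem wEnd_eq (i : ℕ) : wEnd p K S R i = DP.partialMap p (height S R) K (.y i) +
    DP.mulMono p (height S R) K (topXY p S R i) * wEnd p K S R (i + 1) := by
  ext1 f
  have := congrArg (fun D => D f) (tower_eq p K S R .y (fun _ _ h => CloverVar.y.inj h)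
    (fun k => top p K S R (.y k) * top p K S R (.x k)) i)
  refine Eq.trans this ?_
  change _ + _ * _ = _ + DP.mono _ _ _ _ * _
  rw [mul_comm (top p K S R _), top_mul_top (by simp)]
  rfl

theorem uEnd_eq (i : ℕ) : uEnd p K S R i = DP.partialMap p (height S R) K (.z i) +
    DP.mulMono p (height S R) K (topXZ p S R i) * uEnd p K S R (i + 1) := by
  ext1 f
  have := congrArg (fun D => D f) (tower_eq p K S R .z (fun _ _ h => CloverVar.z.inj h)
    (fun k => top p K S R (.z k) * top p K S R (.x k)) i)
  refine Eq.trans this ?_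
  change _ + _ * _ = _ + DP.mono _ _ _ _ * _
  rw [mul_comm (top p K S R _), top_mul_top (by simp)]
  rfl

/-- The weight p^S + p^R - 1 is forced here: it exceeds the degree (p^S - 1) + (p^R - 1) of the
coefficient in the recursion by exactly 1. -/
theorem gensAt_subset_span (i : ℕ) : gensAt p K S R i ⊆
    Submodule.span K (levelGen p (height S R) K (level i) (gensAt p K S R (i + 1))
      (p ^ S i + p ^ R i - 1) 1) := by
  have hN : 0 < p ^ S i := pow_pos (Fact.out : p.Prime).pos _
  have hM : 0 < p ^ R i := pow_pos (Fact.out : p.Prime).pos _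
  rintro _ (rfl | rfl | rfl)
  · rw [vEnd_eq]
    refine add_mem (Submodule.subset_span (Or.inl ⟨.x i, by simp [level], 0, by simp, by simp⟩))
      (Submodule.subset_span (Or.inr ⟨_, 1, _, fun t ht => topXY_eq_zero ht,
        .gen (by simp [gensAt]), ?_, rfl⟩))
    simp only [topXY, map_add, Finsupp.degree_single]
    omega
  · rw [wEnd_eq]
    refine add_mem (Submodule.subset_span (Or.inl ⟨.y i, by simp [level], 0, by simp, by simp⟩))
      (Submodule.subset_span (Or.inr ⟨_, 1, _, fun t ht => topXY_eq_zero ht,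
        .gen (by simp [gensAt]), ?_, rfl⟩))
    simp only [topXY, map_add, Finsupp.degree_single]
    omega
  · rw [uEnd_eq]
    refine add_mem (Submodule.subset_span (Or.inl ⟨.z i, by simp [level], 0, by simp, by simp⟩))
      (Submodule.subset_span (Or.inr ⟨_, 1, _, fun t ht => topXZ_eq_zero ht,
        .gen (by simp [gensAt]), ?_, rfl⟩))
    simp only [topXZ, map_add, Finsupp.degree_single]
    omega

end Tower

/-! ### The upper bound for the growth -/

section Upper

variable [Fact p.Prime] [CharP K p]

theorem eq_single_add_of_level {α : CloverVar →₀ ℕ} {i : ℕ} (h : ∀ t ∉ level i, α t = 0) :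
    α = Finsupp.single (.x i) (α (.x i)) + Finsupp.single (.y i) (α (.y i)) +
      Finsupp.single (.z i) (α (.z i)) := by
  classical
  ext t
  by_cases ht : t ∈ level i
  · rcases ht with rfl | rfl | rfl <;> simp
  · have h0 := h t ht
    simp only [level, Set.mem_insert_iff, Set.mem_singleton_iff, not_or] at ht
    simp [h0, ht]

/-- One step of the recursion. There are S + 2R nonzero operators ∂_t^(p^k) and p^(S+2R) nonzero
monomials of the level. The number p^S + 2p^R - 3 is the largest degree of such a monomial, hence
the largest possible gain in weight. -/
theorem exists_finset_span_succ {i n n' d : ℕ} {s' : Finset (Module.End K (Alg p K S R))}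
    (hs' : ∀ a, LieReach K p (gensAt p K S R (i + 1)) n' a → a ∈ Submodule.span K (s' : Set _))
    (hd : s'.card ≤ d)
    (hn : ∀ m, (p ^ S i + p ^ R i - 1) * m ≤ n + (p ^ S i + 2 * p ^ R i - 3) → m ≤ n') :
    ∃ s : Finset (Module.End K (Alg p K S R)),
      (∀ a, LieReach K p (gensAt p K S R i) n a → a ∈ Submodule.span K (s : Set _)) ∧
      s.card ≤ (S i + 2 * R i) + p ^ (S i + 2 * R i) * d := by
  classical
  have hp := (Fact.out : p.Prime)
  let D (t : CloverVar) : Finset (Module.End K (Alg p K S R)) :=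
    (Finset.range (height S R t)).image fun k => DP.partialMap p (height S R) K t ^ p ^ k
  let box := Finset.range (p ^ S i) ×ˢ Finset.range (p ^ R i) ×ˢ Finset.range (p ^ R i)
  let E : Finset (Module.End K (Alg p K S R)) := (box ×ˢ s').image fun e =>
    DP.mulMono p (height S R) K (Finsupp.single (.x i) e.1.1 + Finsupp.single (.y i) e.1.2.1 +
      Finsupp.single (.z i) e.1.2.2) * e.2
  refine ⟨(D (.x i) ∪ (D (.y i) ∪ D (.z i))) ∪ E, fun a ha => ?_, ?_⟩
  · have h1 := ha.mem_span_levelGen (gensAt_subset (Nat.lt_succ_self i)) (gensAt_subset_span i)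
    refine Submodule.span_le.2 ?_ h1
    have hD (t : CloverVar) (k : ℕ) (hD : D t ⊆ (D (.x i) ∪ (D (.y i) ∪ D (.z i))) ∪ E) :
        DP.partialMap p (height S R) K t ^ p ^ k ∈ Submodule.span K
          (((D (.x i) ∪ (D (.y i) ∪ D (.z i))) ∪ E : Finset _) : Set _) := by
      by_cases hk : k < height S R t
      · exact Submodule.subset_span (hD (Finset.mem_image_of_mem _ (Finset.mem_range.2 hk)))
      · rw [DP.partialMap_pow_eq_zero t (Nat.pow_le_pow_right hp.pos (not_lt.1 hk))]
        exact zero_mem _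
    rintro _ (⟨t, ht, k, -, rfl⟩ | ⟨α, m, g, hα, hg, hm, rfl⟩)
    · refine hD t k ?_
      rcases ht with rfl | rfl | rfl <;> intro a ha <;> simp only [Finset.mem_union] <;> tauto
    · by_cases hr : ∀ t, α t < p ^ height S R t
      · have hx : α (.x i) < p ^ S i := hr (.x i)
        have hy : α (.y i) < p ^ R i := hr (.y i)
        have hz : α (.z i) < p ^ R i := hr (.z i)
        have hα' := eq_single_add_of_level hα
        have hdeg : α.degree = α (.x i) + α (.y i) + α (.z i) := by
          conv_lhs => rw [hα']
          simp only [map_add, Finsupp.degree_single]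
        have hg' := hs' g (.mono (hn m (by omega)) hg)
        change _ ∈ Submodule.span K _
        refine Submodule.span_induction (p := fun g _ => DP.mulMono p (height S R) K α * g ∈
          Submodule.span K _) (fun g hg => ?_) ?_ (fun g h _ _ hg hh => ?_) (fun c g _ hg => ?_) hg'
        · refine Submodule.subset_span (Finset.mem_union_right _ (Finset.mem_image.2
            ⟨((α (.x i), α (.y i), α (.z i)), g), ?_, ?_⟩))
          · simp only [box, Finset.mem_product, Finset.mem_range]
            exact ⟨⟨hx, hy, hz⟩, hg⟩
          · simp only
            rw [← hα']
        · rw [mul_zero]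
          exact zero_mem _
        · rw [mul_add]
          exact add_mem hg hh
        · rw [mul_smul_comm]
          exact Submodule.smul_mem _ _ hg
      · rw [DP.mulMono_eq_zero hr, zero_mul]
        exact zero_mem _
  · have hD (t : CloverVar) : (D t).card ≤ height S R t :=
      Finset.card_image_le.trans (by simp)
    have hE : E.card ≤ p ^ (S i + 2 * R i) * d := by
      refine Finset.card_image_le.trans ?_
      rw [Finset.card_product]
      refine Nat.mul_le_mul (le_of_eq ?_) hd
      simp only [box, Finset.card_product, Finset.card_range]
      ring
    have h1 := hD (.x i)
    have h2 := hD (.y i)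
    have h3 := hD (.z i)
    simp only [height] at h1 h2 h3
    refine (Finset.card_union_le _ _).trans (add_le_add ((Finset.card_union_le _ _).trans ?_) hE)
    have h4 := Finset.card_union_le (D (.y i)) (D (.z i))
    omega

end Upper

end Clover

/-! ### Comparison of the growth filtration with the degree filtration -/

section GrowthReach

variable {K : Type*} [Field K] {p : ℕ} {A : Type*} [Ring A] [Algebra K A]

theorem LieReach.rightNormed_coe {L : RestrictedLieSubalgebra K p A} {X : Set A}
    {l : List L.toLieSubalgebra} (hl : ∀ x ∈ l, x.1 ∈ X) :
    LieReach K p X l.length (rightNormed l).1 := by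
  induction l with
  | nil => exact .zero _
  | cons x l ih =>
    cases l with
    | nil => exact .gen (hl x (by simp))
    | cons y l =>
      have h1 : LieReach K p X 1 x.1 := .gen (hl x (by simp))
      have := h1.lie (ih fun z hz => hl z (List.mem_cons_of_mem _ hz))
      rw [List.length_cons, add_comm]
      exact this

theorem RestrictedLieSubalgebra.pMap_iterate_coe (L : RestrictedLieSubalgebra K p A)
    (x : L.toLieSubalgebra) (k : ℕ) : (L.pMap^[k] x).1 = x.1 ^ p ^ k := by
  induction k with
  | zero => simp
  | succ k ih =>
    rw [Function.iterate_succ_apply', pow_succ, pow_mul, ← ih]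
    rfl

/-- Only this inclusion is needed: an upper bound for the larger filtration, with arbitrary brackets
and powers, bounds the growth function. -/
theorem LieReach.of_mem_growthSpace {L : RestrictedLieSubalgebra K p A}
    {X : Set L.toLieSubalgebra} {Y : Set A} (hX : ∀ x ∈ X, x.1 ∈ Y) {n : ℕ}
    {a : L.toLieSubalgebra} (ha : a ∈ growthSpace L X n) : LieReach K p Y n a.1 := by
  induction ha using Submodule.span_induction with
  | zero => exact .zero _
  | add x y _ _ hx hy => exact hx.add hy
  | smul c x _ hx => exact hx.smul c
  | mem x hx =>
    obtain ⟨l, k, -, hl, hn, rfl⟩ := hx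
    rw [L.pMap_iterate_coe]
    have := (LieReach.rightNormed_coe (X := Y) fun x hx => hX x (hl x hx)).pow_iterate k
    exact .mono (by rwa [mul_comm]) this

end GrowthReach

/-! ### Solving the recursion for the upper bound -/

namespace Clover

variable {p : ℕ} {K : Type*} [Field K] [Fact p.Prime] [CharP K p]

/-- A finite spanning set of the elements of degree at most `n`, for the pivot elements of any
level and a constant tuple. -/
theorem exists_finset_span {s r : ℕ} (hs : 0 < s) (hr : 0 < r) (k : ℕ) : ∀ i n : ℕ,
    n * (p ^ s + p ^ r - 2) < p ^ s + 2 * p ^ r - 3 + (p ^ s - 1) * (p ^ s + p ^ r - 1) ^ k →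
    ∃ t : Finset (Module.End K (Alg p K (fun _ => s) (fun _ => r))),
      (∀ a, LieReach K p (gensAt p K (fun _ => s) (fun _ => r) i) n a →
        a ∈ Submodule.span K (t : Set _)) ∧
      t.card + 2 ≤ 5 * (p ^ (s + 2 * r)) ^ k := by
  classical
  have hp := (Fact.out : p.Prime)
  have hN : 2 ≤ p ^ s := hp.two_le.trans (Nat.le_self_pow hs.ne' p)
  have hM : 2 ≤ p ^ r := hp.two_le.trans (Nat.le_self_pow hr.ne' p)
  induction k with
  | zero =>
    intro i n hn
    -- For k = 0 the right side of the hypothesis is exactly 2 (p^s + p^r - 2).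
    have hn1 : n ≤ 1 := by
      by_contra h
      have : 2 * (p ^ s + p ^ r - 2) ≤ n * (p ^ s + p ^ r - 2) :=
        Nat.mul_le_mul_right _ (by omega)
      rw [pow_zero, mul_one] at hn
      omega
    refine ⟨{vEnd p K _ _ i, wEnd p K _ _ i, uEnd p K _ _ i}, fun a ha => ?_, ?_⟩
    · have := (ha.mono hn1).low hp.one_lt
      simpa [gensAt] using this.2 rfl
    · have := Finset.card_le_three (a := vEnd p K (fun _ => s) (fun _ => r) i)
        (b := wEnd p K (fun _ => s) (fun _ => r) i) (c := uEnd p K (fun _ => s) (fun _ => r) i)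
      rw [pow_zero]
      omega
  | succ k ih =>
    intro i n hn
    obtain ⟨m, hm⟩ : ∃ m, p ^ s + p ^ r = m + 2 := ⟨p ^ s + p ^ r - 2, by omega⟩
    obtain ⟨D, hD⟩ : ∃ D, p ^ s + 2 * p ^ r - 3 = D := ⟨_, rfl⟩
    obtain ⟨d, hd⟩ : ∃ d, D = m + d := ⟨D - m, by omega⟩
    have e1 : p ^ s + p ^ r - 1 = m + 1 := by omega
    have e2 : p ^ s + p ^ r - 2 = m := by omega
    rw [e1, e2, hD] at hn ih
    have hdiv := Nat.div_mul_le_self (n + D) (m + 1)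
    set n' := (n + D) / (m + 1)
    -- The map n ↦ (n + D)/(m + 1) has fixed point D/m and contracts by m + 1, so n m - D is the
    -- quantity to track.
    have hn' : n' * m < D + (p ^ s - 1) * (m + 1) ^ k := by
      refine Nat.lt_of_mul_lt_mul_right (a := m + 1) ?_
      calc n' * m * (m + 1) = n' * (m + 1) * m := by ring
        _ ≤ (n + D) * m := Nat.mul_le_mul_right _ hdiv
        _ = n * m + D * m := by ring
        _ < D + (p ^ s - 1) * (m + 1) ^ (k + 1) + D * m := by omega
        _ = (D + (p ^ s - 1) * (m + 1) ^ k) * (m + 1) := by ring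
    obtain ⟨t', ht', hc⟩ := ih (i + 1) n' hn'
    obtain ⟨t, ht, hc'⟩ := exists_finset_span_succ (n := n) ht' le_rfl (fun l hl => by
      rw [Nat.le_div_iff_mul_le (by omega), mul_comm, ← e1, ← hD]
      exact hl)
    refine ⟨t, ht, ?_⟩
    -- The summand 2 in the bound on the cardinality, multiplied by p^(s+2r), absorbs the s + 2r
    -- powers of derivations added at each level.
    have h1 : s + 2 * r < p ^ (s + 2 * r) := Nat.lt_pow_self hp.one_lt
    have h2 : 2 ≤ p ^ (s + 2 * r) := hp.two_le.trans (Nat.le_self_pow (by omega) p)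
    rw [pow_succ]
    nlinarith [Nat.mul_le_mul_left (p ^ (s + 2 * r)) hc]

/-- The space of elements of degree at most `n` is finite-dimensional, of dimension bounded by a
power of `p ^ (s + 2 r)`. -/
theorem growth_le {s r : ℕ} (hs : 0 < s) (hr : 0 < r) {k n : ℕ}
    (hn : n * (p ^ s + p ^ r - 2) < p ^ s + 2 * p ^ r - 3 + (p ^ s - 1) * (p ^ s + p ^ r - 1) ^ k) :
    FiniteDimensional K (growthSpace (T p K (fun _ => s) (fun _ => r))
      (genSet p K (fun _ => s) (fun _ => r)) n) ∧
    growth (T p K (fun _ => s) (fun _ => r)) (genSet p K (fun _ => s) (fun _ => r)) n ≤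
      5 * (p ^ (s + 2 * r)) ^ k := by
  obtain ⟨t, ht, hc⟩ := exists_finset_span (K := K) hs hr k 0 n hn
  set V := growthSpace (T p K (fun _ => s) (fun _ => r)) (genSet p K (fun _ => s) (fun _ => r)) n
  let f : V →ₗ[K] Submodule.span K (t : Set (Module.End K (Alg p K (fun _ => s) (fun _ => r)))) :=
    LinearMap.codRestrict _
      ((T p K (fun _ => s) (fun _ => r)).toLieSubalgebra.toSubmodule.subtype ∘ₗ V.subtype)
      fun a => ht _ (LieReach.of_mem_growthSpace (fun x hx => hx) a.2)
  have hf : Function.Injective f := fun a b hab =>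
    Subtype.ext (Subtype.ext (congrArg (fun c => c.1) hab))
  refine ⟨FiniteDimensional.of_injective f hf, ?_⟩
  have h1 := LinearMap.finrank_le_finrank_of_injective hf
  have h2 := finrank_span_finset_le_card (R := K) t
  exact h1.trans (h2.trans (by omega))

end Clover

/-! ### Filtrations of ideals -/

section IdealReach

variable (K : Type*) [Field K] {A : Type*} [Ring A] [Algebra K A]

/-- The linear map `a ↦ g a - a g`. -/
noncomputable abbrev adMap (g : A) : Module.End K A :=
  LinearMap.mulLeft K g - LinearMap.mulRight K g

/-- `IdealReach K X c n a`: the element `a` has degree at most `n` in the ideal generated by `c` in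
the Lie algebra generated by `X`, where `c` has degree `2`. -/
inductive IdealReach (X : Set A) (c : A) : ℕ → A → Prop
  | base : IdealReach X c 2 c
  | add {n : ℕ} {a b : A} (ha : IdealReach X c n a) (hb : IdealReach X c n b) :
      IdealReach X c n (a + b)
  | smul {n : ℕ} (d : K) {a : A} (ha : IdealReach X c n a) : IdealReach X c n (d • a)
  | lie {n : ℕ} {x a : A} (hx : x ∈ X) (ha : IdealReach X c n a) :
      IdealReach X c (n + 1) (adMap K x a)
  | mono {m n : ℕ} (hmn : m ≤ n) {a : A} (ha : IdealReach X c m a) : IdealReach X c n a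

variable {K} {X : Set A} {c : A}

theorem IdealReach.two_le {n : ℕ} {a : A} (h : IdealReach K X c n a) : 2 ≤ n := by
  induction h with
  | base => exact le_rfl
  | add _ _ ha _ => exact ha
  | smul _ _ ha => exact ha
  | lie _ _ ha => omega
  | mono h _ ha => omega

theorem IdealReach.mem_subalgebra {Z : Subalgebra K A} (hX : X ⊆ Z) (hc : c ∈ Z) {n : ℕ} {a : A}
    (h : IdealReach K X c n a) : a ∈ Z := by
  induction h with
  | base => exact hc
  | add _ _ ha hb => exact add_mem ha hb
  | smul d _ ha => exact Subalgebra.smul_mem _ ha d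
  | lie hx _ ha => exact sub_mem (mul_mem (hX hx) ha) (mul_mem ha (hX hx))
  | mono _ _ ha => exact ha

theorem IdealReach.lie_iterate {g : A} {m : ℕ}
    (hg : ∀ n a, IdealReach K X c n a → IdealReach K X c (n + m) (adMap K g a)) {n : ℕ} {a : A}
    (h : IdealReach K X c n a) (j : ℕ) : IdealReach K X c (n + j * m) ((adMap K g ^ j) a) := by
  induction j with
  | zero => simpa using h
  | succ j ih =>
    rw [pow_succ', Module.End.mul_apply, Nat.succ_mul, ← add_assoc]
    exact hg _ _ ih

theorem IdealReach.lie_pow {x : A} (hx : x ∈ X) {n : ℕ} {a : A} (h : IdealReach K X c n a)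
    (j : ℕ) : IdealReach K X c (n + j) ((adMap K x ^ j) a) := by
  simpa using h.lie_iterate (m := 1) (fun _ _ h => .lie hx h) j

/-- The filtration is defined by bracketing with generators only. The Jacobi identity and ad(x^p) =
ad(x)^p extend this to every element of the restricted algebra, with additive degrees. -/
theorem IdealReach.lie_of_lieReach [Nontrivial A] {p : ℕ} [Fact p.Prime] [CharP K p] {m : ℕ}
    {b : A} (hb : LieReach K p X m b) {n : ℕ} {a : A} (ha : IdealReach K X c n a) :
    IdealReach K X c (n + m) (adMap K b a) := by
  induction hb generalizing n a with
  | gen hx => exact .lie hx ha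
  | zero m =>
    have := (ha.smul 0).mono (Nat.le_add_right n m)
    simpa [adMap] using this
  | @add m x y _ _ hx hy =>
    have e : adMap K (x + y) a = adMap K x a + adMap K y a := by
      simp only [LinearMap.sub_apply, LinearMap.mulLeft_apply, LinearMap.mulRight_apply]
      noncomm_ring
    rw [e]
    exact (hx ha).add (hy ha)
  | @smul m d x _ hx =>
    have e : adMap K (d • x) a = d • adMap K x a := by
      simp [smul_sub]
    rw [e]
    exact (hx ha).smul d
  | @lie m n' x y _ _ hx hy =>
    have e : adMap K (x * y - y * x) a =
        adMap K x (adMap K y a) + (-1 : K) • adMap K y (adMap K x a) := by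
      simp only [LinearMap.sub_apply, LinearMap.mulLeft_apply, LinearMap.mulRight_apply, neg_smul,
        one_smul]
      noncomm_ring
    rw [e]
    exact ((hx (hy ha)).mono (by omega)).add (((hy (hx ha)).mono (by omega)).smul _)
  | @pow m x _ hx =>
    have e : adMap K (x ^ p) a = (adMap K x ^ p) a := by
      have := mulLeft_sub_mulRight_pow_char_pow p K x a 1
      rw [pow_one] at this
      rw [this]
      simp
    rw [e]
    exact ha.lie_iterate (fun _ _ h => hx h) p
  | mono h _ hx => exact (hx ha).mono (by omega)

theorem LieReach.lie_iterate {p : ℕ} {g : A} {m : ℕ} (hg : LieReach K p X m g) {n : ℕ} {a : A}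
    (h : LieReach K p X n a) (j : ℕ) : LieReach K p X (n + j * m) ((adMap K g ^ j) a) := by
  induction j with
  | zero => simpa using h
  | succ j ih =>
    rw [pow_succ', Module.End.mul_apply, Nat.succ_mul, ← add_assoc, add_comm]
    exact hg.lie ih

theorem LieReach.lie_pow {p : ℕ} {x : A} (hx : x ∈ X) {n : ℕ} {a : A}
    (h : LieReach K p X n a) (j : ℕ) : LieReach K p X (n + j) ((adMap K x ^ j) a) := by
  simpa using (LieReach.gen hx).lie_iterate h j

end IdealReach

/-! ### Lowering exponents -/

section Lowering

variable {Θ : Type*} {p : ℕ} {H : Θ → ℕ} {K : Type*} [Field K]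
  {B : Set Θ}

theorem DP.mulMono_mul_eq_zero {t : Θ} {α β : Θ →₀ ℕ} (h : p ^ H t ≤ α t + β t) :
    DP.mulMono p H K α * DP.mulMono p H K β = 0 := by
  rw [DP.mulMono_mul_mulMono, DP.mulMono_eq_zero, smul_zero]
  exact fun h0 => absurd (h0 t) (by simpa using h)

theorem DP.mulMono_mul_of_disjoint {α β : Θ →₀ ℕ} (h : ∀ a, α a = 0 ∨ β a = 0) :
    DP.mulMono p H K α * DP.mulMono p H K β = DP.mulMono p H K (α + β) := by
  rw [DP.mulMono_mul_mulMono, DP.coef_eq_one h, Nat.cast_one, one_smul]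

variable {t : Θ} {τ : Θ →₀ ℕ} {g₀ : Module.End K (DP p H K)}

/-- The pivot acts by its derivation on the monomial and by its tail on the next-level factor. The
lemmas below isolate cases in which one of these two terms vanishes. -/
theorem lie_pivot_mulMono (ht : t ∈ B) (hτ : ∀ s ∉ B, τ s = 0)
    (hg₀ : g₀ ∈ levelCentralizer p H K B) {α : Θ →₀ ℕ} (hα : ∀ s ∉ B, α s = 0)
    {g : Module.End K (DP p H K)} (hg : g ∈ levelCentralizer p H K B) :
    adMap K (DP.partialMap p H K t + DP.mulMono p H K τ * g₀) (DP.mulMono p H K α * g) =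
      adMap K (DP.partialMap p H K t) (DP.mulMono p H K α) * g +
      DP.mulMono p H K τ * DP.mulMono p H K α * adMap K g₀ g := by
  have h1 := lie_mulMono_mul (levelCentralizer_commute_mulMono hg₀ hα)
    (levelCentralizer_commute_mulMono hg hτ)
  have h2 := lie_mul_of_commute (a := DP.mulMono p H K α)
    (levelCentralizer_commute_partialMap hg ht)
  simp only [LinearMap.sub_apply, LinearMap.mulLeft_apply, LinearMap.mulRight_apply]
  rw [← h1, ← h2, add_mul, mul_add]
  abel

variable [Fact p.Prime] [CharP K p]

theorem DP.lie_partialMap_mulMono_add (t : Θ) {β : Θ →₀ ℕ} (h : β t + 1 < p ^ H t) :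
    adMap K (DP.partialMap p H K t) (DP.mulMono p H K (β + Finsupp.single t 1)) =
      DP.mulMono p H K β := by
  by_cases hr : ∀ a, (β + Finsupp.single t 1 : Θ →₀ ℕ) a < p ^ H a
  · have := DP.partialMap_mul_mulMono (K := K) t ⟨_, hr⟩
    refine this.trans ?_
    rw [if_neg (by simp), add_tsub_cancel_right]
  · rw [DP.mulMono_eq_zero hr, map_zero, DP.mulMono_eq_zero]
    refine fun h0 => hr fun a => ?_
    by_cases ha : t = a
    · subst ha
      simpa using h
    · simpa [ha] using h0 a

theorem DP.commute_partialMap_mulMono {t : Θ} {α : Θ →₀ ℕ} (h : α t = 0) :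
    Commute (DP.partialMap p H K t) (DP.mulMono p H K α) := by
  by_cases hr : ∀ a, α a < p ^ H a
  · have := DP.partialMap_mul_mulMono (K := K) t ⟨_, hr⟩
    rw [if_pos h] at this
    exact sub_eq_zero.1 this
  · rw [DP.mulMono_eq_zero hr]
    exact Commute.zero_right _

/-- While the exponent of t is positive, multiplying by τ, which has top exponent in t, overflows.
The pivot therefore acts as ∂_t until that exponent reaches 0. -/
theorem lie_pivot_pow_mulMono (ht : t ∈ B) (hτ : ∀ s ∉ B, τ s = 0) (hτt : p ^ H t ≤ τ t + 1)
    (hg₀ : g₀ ∈ levelCentralizer p H K B) {α : Θ →₀ ℕ} (hα : ∀ s ∉ B, α s = 0)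
    {g : Module.End K (DP p H K)} (hg : g ∈ levelCentralizer p H K B) {j : ℕ}
    (hj : α t + j < p ^ H t) :
    (adMap K (DP.partialMap p H K t + DP.mulMono p H K τ * g₀) ^ j)
      (DP.mulMono p H K (α + Finsupp.single t j) * g) = DP.mulMono p H K α * g := by
  induction j with
  | zero => simp
  | succ j ih =>
    have h1 : ∀ s ∉ B, (α + Finsupp.single t j + Finsupp.single t 1 : Θ →₀ ℕ) s = 0 := fun s hs => by
      have : t ≠ s := fun h => hs (h ▸ ht)
      simp [hα s hs, this]
    rw [pow_succ, Module.End.mul_apply, Finsupp.single_add, ← add_assoc,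
      lie_pivot_mulMono ht hτ hg₀ h1 hg, DP.lie_partialMap_mulMono_add t (by simp; omega),
      DP.mulMono_mul_eq_zero (t := t) (by simp; omega), zero_mul, add_zero]
    exact ih (by omega)

/-- Once the exponent of t is exhausted, only the tail acts: the bracket carries over to the next
level and the monomial is multiplied by τ. -/
theorem lie_pivot_mulMono_of_eq_zero (ht : t ∈ B) (hτ : ∀ s ∉ B, τ s = 0)
    (hg₀ : g₀ ∈ levelCentralizer p H K B) {α : Θ →₀ ℕ} (hα : ∀ s ∉ B, α s = 0) (hαt : α t = 0)
    {g : Module.End K (DP p H K)} (hg : g ∈ levelCentralizer p H K B) :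
    adMap K (DP.partialMap p H K t + DP.mulMono p H K τ * g₀) (DP.mulMono p H K α * g) =
      DP.mulMono p H K τ * DP.mulMono p H K α * adMap K g₀ g := by
  rw [lie_pivot_mulMono ht hτ hg₀ hα hg, LinearMap.sub_apply, LinearMap.mulLeft_apply,
    LinearMap.mulRight_apply, (DP.commute_partialMap_mulMono hαt).eq, sub_self, zero_mul, zero_add]

/-- Recovering the pivot element of the next level from two pivot elements. -/
theorem lie_pivot_pow_pivot {t' : Θ} (ht : t ∈ B) (ht' : t' ∈ B) (htt : t ≠ t')
    (h1 : 2 ≤ p ^ H t) (h2 : 2 ≤ p ^ H t')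
    (hτ : τ = Finsupp.single t (p ^ H t - 1) + Finsupp.single t' (p ^ H t' - 1))
    {g g' : Module.End K (DP p H K)} (hg : g ∈ levelCentralizer p H K B)
    (hg' : g' ∈ levelCentralizer p H K B) :
    (adMap K (DP.partialMap p H K t' + DP.mulMono p H K τ * g') ^ (p ^ H t' - 2))
      ((adMap K (DP.partialMap p H K t + DP.mulMono p H K τ * g) ^ (p ^ H t))
        (DP.partialMap p H K t' + DP.mulMono p H K τ * g')) = -g := by
  have htt' : t' ≠ t := htt.symm
  have hτB : ∀ s ∉ B, τ s = 0 := fun s hs => by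
    have e1 : t ≠ s := fun h => hs (h ▸ ht)
    have e2 : t' ≠ s := fun h => hs (h ▸ ht')
    simp [hτ, e1, e2]
  have hB (n : ℕ) : ∀ s ∉ B, (Finsupp.single t' n) s = 0 := fun s hs => by
    have e2 : t' ≠ s := fun h => hs (h ▸ ht')
    simp [e2]
  have hτt : p ^ H t ≤ τ t + 1 := by simp [hτ, htt']; omega
  have hτt' : p ^ H t' ≤ τ t' + 1 := by simp [hτ, htt]; omega
  obtain ⟨n, hn⟩ : ∃ n, p ^ H t = n + 1 := ⟨p ^ H t - 1, by omega⟩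
  set V := DP.partialMap p H K t + DP.mulMono p H K τ * g with hV
  -- Bracketing V with ∂_{t'} differentiates τ once in t'. This term survives; its exponents are
  -- then lowered to 0, first in t and then in t'.
  have e1 : adMap K V (DP.partialMap p H K t') =
      -(DP.mulMono p H K (Finsupp.single t' (p ^ H t' - 2) + Finsupp.single t n) * g) := by
    have e : τ = Finsupp.single t' (p ^ H t' - 2) + Finsupp.single t n +
        Finsupp.single t' 1 := by
      rw [hτ, hn, add_right_comm, ← Finsupp.single_add, add_comm, Nat.add_sub_cancel,
        show p ^ H t' - 2 + 1 = p ^ H t' - 1 by omega]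
    have h3 := lie_mul_of_commute (a := DP.mulMono p H K τ)
      (levelCentralizer_commute_partialMap hg ht')
    have h4 := DP.lie_partialMap_mulMono_add (K := K) (p := p) (H := H) t'
      (β := Finsupp.single t' (p ^ H t' - 2) + Finsupp.single t n) (by simp [htt]; omega)
    rw [← e] at h4
    rw [← h4]
    simp only [LinearMap.sub_apply, LinearMap.mulLeft_apply, LinearMap.mulRight_apply]
    rw [← h3, hV, add_mul, mul_add, (DP.partialMap_commute t t').eq]
    abel
  have e2 : (adMap K V ^ n) (DP.mulMono p H K τ * g') =
      DP.mulMono p H K (Finsupp.single t' (p ^ H t' - 1)) * g' := by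
    have e : τ = Finsupp.single t' (p ^ H t' - 1) + Finsupp.single t n := by
      rw [hτ, hn, add_comm, Nat.add_sub_cancel]
    conv_lhs => rw [e]
    exact lie_pivot_pow_mulMono ht hτB hτt hg (hB _) hg' (by simp [htt']; omega)
  have e3 : (adMap K V ^ n) (DP.mulMono p H K
      (Finsupp.single t' (p ^ H t' - 2) + Finsupp.single t n) * g) =
      DP.mulMono p H K (Finsupp.single t' (p ^ H t' - 2)) * g :=
    lie_pivot_pow_mulMono ht hτB hτt hg (hB _) hg (by simp [htt']; omega)
  have e4 : (adMap K V ^ (n + 1)) (DP.partialMap p H K t' + DP.mulMono p H K τ * g') =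
      -(DP.mulMono p H K (Finsupp.single t' (p ^ H t' - 2)) * g) := by
    rw [map_add]
    nth_rewrite 1 [pow_succ]
    -- The part coming from τ g' dies at the last bracket, where τ meets the top power of t'.
    rw [pow_succ', Module.End.mul_apply, Module.End.mul_apply, e1, e2, map_neg, e3,
      lie_pivot_mulMono_of_eq_zero ht hτB hg (hB _) (by simp [htt']) hg',
      DP.mulMono_mul_eq_zero (t := t') (by simp; omega), zero_mul, add_zero]
  rw [hn, e4, map_neg]
  have := lie_pivot_pow_mulMono ht' hτB hτt' hg' (α := 0) (by simp) hg (j := p ^ H t' - 2)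
    (by simp; omega)
  rw [zero_add, DP.mulMono_zero, one_mul] at this
  rw [this]

end Lowering

namespace Clover

/-! ### The lower bound for the growth -/

section Lower

variable {p : ℕ} {K : Type*} [Field K] {S R : ℕ → ℕ}

/-- The exponent of `x_i^{(a)} y_i^{(b)} z_i^{(c)}`. -/
noncomputable def levelExp (i a b c : ℕ) : CloverVar →₀ ℕ :=
  Finsupp.single (.x i) a + Finsupp.single (.y i) b + Finsupp.single (.z i) c

theorem levelExp_eq_zero {i a b c : ℕ} {t : CloverVar} (ht : t ∉ level i) :
    levelExp i a b c t = 0 := by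
  simp only [level, Set.mem_insert_iff, Set.mem_singleton_iff, not_or] at ht
  simp [levelExp, ht]

theorem single_eq_zero_of_level {i : ℕ} {s t : CloverVar} (hs : s ∈ level i) (ht : t ∉ level i)
    (n : ℕ) : Finsupp.single s n t = 0 := by
  have : s ≠ t := fun h => ht (h ▸ hs)
  simp [this]

theorem levelExp_add_single_x (i a b c j : ℕ) :
    levelExp i a b c + Finsupp.single (.x i) j = levelExp i (a + j) b c := by
  simp only [levelExp, Finsupp.single_add]
  abel

theorem levelExp_add_single_y (i a b c j : ℕ) :
    levelExp i a b c + Finsupp.single (.y i) j = levelExp i a (b + j) c := by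
  simp only [levelExp, Finsupp.single_add]
  abel

theorem levelExp_add_single_z (i a b c j : ℕ) :
    levelExp i a b c + Finsupp.single (.z i) j = levelExp i a b (c + j) := by
  simp only [levelExp, Finsupp.single_add]
  abel

theorem levelExp_zero (i : ℕ) : levelExp i 0 0 0 = 0 := by
  simp [levelExp]

theorem topXY_eq (i : ℕ) : topXY p S R i = levelExp i (p ^ S i - 1) (p ^ R i - 1) 0 := by
  simp [topXY, levelExp]

theorem topXZ_eq (i : ℕ) : topXZ p S R i = levelExp i (p ^ S i - 1) 0 (p ^ R i - 1) := by
  simp [topXZ, levelExp]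

@[simp] theorem levelExp_x (i a b c : ℕ) : levelExp i a b c (.x i) = a := by
  simp [levelExp]

@[simp] theorem levelExp_y (i a b c : ℕ) : levelExp i a b c (.y i) = b := by
  simp [levelExp]

@[simp] theorem levelExp_z (i a b c : ℕ) : levelExp i a b c (.z i) = c := by
  simp [levelExp]

variable [Fact p.Prime]

theorem two_le_prime_pow {n : ℕ} (hn : 0 < n) : 2 ≤ p ^ n :=
  (Fact.out : p.Prime).two_le.trans (Nat.le_self_pow hn.ne' p)

variable (p K S R) in
/-- The operators commuting with the variables of level `i` and their partial derivatives. -/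
noncomputable abbrev cent (i : ℕ) : Subalgebra K (Module.End K (Alg p K S R)) :=
  levelCentralizer p (height S R) K (level i)

variable {i : ℕ} {g : Module.End K (Alg p K S R)}

variable [CharP K p]

theorem lower_x (hg : g ∈ cent p K S R i) {a b c j : ℕ} (h : a + j < p ^ S i) :
    (adMap K (vEnd p K S R i) ^ j) (DP.mulMono p (height S R) K (levelExp i (a + j) b c) * g) =
      DP.mulMono p (height S R) K (levelExp i a b c) * g := by
  rw [vEnd_eq, ← levelExp_add_single_x]
  refine lie_pivot_pow_mulMono (B := level i) (by simp [level]) (fun _ => topXY_eq_zero) ?_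
    (vEnd_mem (Nat.lt_succ_self i)) (fun _ => levelExp_eq_zero) hg (by simpa [height] using h)
  rw [topXY_eq, levelExp_x]
  change p ^ S i ≤ _
  omega

theorem lower_y (hg : g ∈ cent p K S R i) {a b c j : ℕ} (h : b + j < p ^ R i) :
    (adMap K (wEnd p K S R i) ^ j) (DP.mulMono p (height S R) K (levelExp i a (b + j) c) * g) =
      DP.mulMono p (height S R) K (levelExp i a b c) * g := by
  rw [wEnd_eq, ← levelExp_add_single_y]
  refine lie_pivot_pow_mulMono (B := level i) (by simp [level]) (fun _ => topXY_eq_zero) ?_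
    (wEnd_mem (Nat.lt_succ_self i)) (fun _ => levelExp_eq_zero) hg (by simpa [height] using h)
  rw [topXY_eq, levelExp_y]
  change p ^ R i ≤ _
  omega

theorem lower_z (hg : g ∈ cent p K S R i) {a b c j : ℕ} (h : c + j < p ^ R i) :
    (adMap K (uEnd p K S R i) ^ j) (DP.mulMono p (height S R) K (levelExp i a b (c + j)) * g) =
      DP.mulMono p (height S R) K (levelExp i a b c) * g := by
  rw [uEnd_eq, ← levelExp_add_single_z]
  refine lie_pivot_pow_mulMono (B := level i) (by simp [level]) (fun _ => topXZ_eq_zero) ?_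
    (uEnd_mem (Nat.lt_succ_self i)) (fun _ => levelExp_eq_zero) hg (by simpa [height] using h)
  rw [topXZ_eq, levelExp_z]
  change p ^ R i ≤ _
  omega

theorem lie_vEnd_partialMap_z (i : ℕ) :
    adMap K (vEnd p K S R i) (DP.partialMap p (height S R) K (.z i)) = 0 := by
  have h1 : Commute (DP.partialMap p (height S R) K (.z i)) (vEnd p K S R i) := by
    rw [vEnd_eq]
    refine (DP.partialMap_commute _ _).add_right (Commute.mul_right ?_ ?_)
    · exact DP.commute_partialMap_mulMono (by simp [topXY_eq])
    · exact (levelCentralizer_commute_partialMap (vEnd_mem (Nat.lt_succ_self i))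
        (by simp [level])).symm
  exact sub_eq_zero.2 h1.eq.symm

theorem lie_vEnd_pow_uEnd {j : ℕ} (hj : 1 ≤ j) (hj' : j < p ^ S i) :
    (adMap K (vEnd p K S R i) ^ j) (uEnd p K S R i) =
      DP.mulMono p (height S R) K (levelExp i (p ^ S i - 1 - j) 0 (p ^ R i - 1)) *
        uEnd p K S R (i + 1) := by
  obtain ⟨l, rfl⟩ := Nat.exists_eq_add_of_le' hj
  have h1 : (adMap K (vEnd p K S R i) ^ (l + 1)) (DP.partialMap p (height S R) K (.z i)) = 0 := by
    rw [pow_succ, Module.End.mul_apply, lie_vEnd_partialMap_z, map_zero]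
  rw [uEnd_eq, map_add, h1, zero_add, topXZ_eq,
    ← lower_x (uEnd_mem (Nat.lt_succ_self i)) (a := p ^ S i - 1 - (l + 1)) (j := l + 1) (by omega),
    show p ^ S i - 1 - (l + 1) + (l + 1) = p ^ S i - 1 by omega]

/-- The first p^S - 1 brackets use up x_i and leave z_i^(p^R - 1) u_{i+1}. One more acts through the
tail of v_i and restores the top power of x_i together with that of y_i. -/
theorem lie_vEnd_pow_uEnd_eq (hS : 0 < S i) :
    (adMap K (vEnd p K S R i) ^ p ^ S i) (uEnd p K S R i) =
      DP.mulMono p (height S R) K (levelExp i (p ^ S i - 1) (p ^ R i - 1) (p ^ R i - 1)) *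
        adMap K (vEnd p K S R (i + 1)) (uEnd p K S R (i + 1)) := by
  have hN := two_le_prime_pow (p := p) hS
  have e : p ^ S i = p ^ S i - 1 + 1 := by omega
  have h1 : (adMap K (vEnd p K S R i) ^ p ^ S i) (uEnd p K S R i) =
      adMap K (vEnd p K S R i) ((adMap K (vEnd p K S R i) ^ (p ^ S i - 1)) (uEnd p K S R i)) := by
    rw [← Module.End.mul_apply, ← pow_succ', ← e]
  rw [h1, lie_vEnd_pow_uEnd (by omega) (by omega), Nat.sub_self, vEnd_eq i,
    lie_pivot_mulMono_of_eq_zero (B := level i) (by simp [level]) (fun _ => topXY_eq_zero)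
      (vEnd_mem (Nat.lt_succ_self i)) (fun _ => levelExp_eq_zero) (by simp)
      (uEnd_mem (Nat.lt_succ_self i)), DP.mulMono_mul_of_disjoint]
  · rw [topXY_eq]
    congr 2
    simp [levelExp]
  · intro t
    rw [topXY_eq]
    by_cases ht : t ∈ level i
    · rcases ht with rfl | rfl | rfl <;> simp
    · exact Or.inl (levelExp_eq_zero ht)

/-- Up to sign, v_{i+1} comes from w_i by bracketing with v_i and then w_i; w_{i+1} is obtained
symmetrically. To get u_{i+1}, strip the powers of x_i and z_i off the tail of u_i. Each costs p^S +
p^R - 1. -/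
theorem lieReach_gensAt_succ (hS : 0 < S i) (hR : 0 < R i) {x : Module.End K (Alg p K S R)}
    (hx : x ∈ gensAt p K S R (i + 1)) :
    LieReach K p (gensAt p K S R i) (p ^ S i + p ^ R i - 1) x := by
  have hN := two_le_prime_pow (p := p) hS
  have hM := two_le_prime_pow (p := p) hR
  have hv : vEnd p K S R i ∈ gensAt p K S R i := by simp [gensAt]
  have hw : wEnd p K S R i ∈ gensAt p K S R i := by simp [gensAt]
  have hu : uEnd p K S R i ∈ gensAt p K S R i := by simp [gensAt]
  have neg {n : ℕ} {a : Module.End K (Alg p K S R)} (h : LieReach K p (gensAt p K S R i) n (-a)) :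
      LieReach K p (gensAt p K S R i) n a := by
    simpa using h.smul (-1)
  rcases hx with rfl | rfl | rfl
  · refine neg ?_
    have h := lie_pivot_pow_pivot (K := K) (H := height S R) (B := level i) (t := .x i)
      (t' := .y i) (τ := topXY p S R i) (by simp [level]) (by simp [level]) (by simp) hN hM rfl
      (vEnd_mem (Nat.lt_succ_self i)) (wEnd_mem (Nat.lt_succ_self i))
    rw [← vEnd_eq, ← wEnd_eq] at h
    rw [← h]
    refine (((LieReach.gen hw).lie_pow hv _).lie_pow hw _).mono ?_
    simp only [height]
    omega
  · refine neg ?_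
    have h := lie_pivot_pow_pivot (K := K) (H := height S R) (B := level i) (t := .y i)
      (t' := .x i) (τ := topXY p S R i) (by simp [level]) (by simp [level]) (by simp) hM hN
      (add_comm _ _) (wEnd_mem (Nat.lt_succ_self i)) (vEnd_mem (Nat.lt_succ_self i))
    rw [← vEnd_eq, ← wEnd_eq] at h
    rw [← h]
    refine (((LieReach.gen hv).lie_pow hw _).lie_pow hv _).mono ?_
    simp only [height]
    omega
  · have h := lower_z (K := K) (S := S) (uEnd_mem (Nat.lt_succ_self i)) (a := 0) (b := 0) (c := 0)
      (j := p ^ R i - 1) (i := i) (R := R) (by omega)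
    have h2 := lie_vEnd_pow_uEnd (K := K) (S := S) (R := R) (i := i) (j := p ^ S i - 1) (by omega) (by omega)
    rw [Nat.sub_self] at h2
    rw [zero_add, ← h2, levelExp_zero, DP.mulMono_zero, one_mul] at h
    rw [← h]
    exact (((LieReach.gen hu).lie_pow hv _).lie_pow hu _).mono (by omega)

variable (p K S R) in
/-- The degree filtration of the ideal generated by `[v_i, u_i]`. -/
abbrev IdealAt (i : ℕ) : ℕ → Module.End K (Alg p K S R) → Prop :=
  IdealReach K (gensAt p K S R i) (adMap K (vEnd p K S R i) (uEnd p K S R i))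

theorem IdealAt.mem_cent {j n : ℕ} (hij : i < j) {a : Module.End K (Alg p K S R)}
    (h : IdealAt p K S R j n a) : a ∈ cent p K S R i :=
  h.mem_subalgebra (gensAt_subset hij)
    (sub_mem (mul_mem (vEnd_mem hij) (uEnd_mem hij)) (mul_mem (uEnd_mem hij) (vEnd_mem hij)))

/-- The generator of the next ideal appears with the top monomial in degree p^S + 1 = 2μ - D, where
μ = p^S + p^R - 1 and D = p^S + 2p^R - 3. Next-level pivots commute with the monomial and cost μ, so
the relation n = μm - D persists. -/
theorem IdealAt.mulMono_top (hS : 0 < S i) (hR : 0 < R i) {m : ℕ}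
    {a : Module.End K (Alg p K S R)} (h : IdealAt p K S R (i + 1) m a) : ∀ n,
    (p ^ S i + p ^ R i - 1) * m ≤ n + (p ^ S i + 2 * p ^ R i - 3) → IdealAt p K S R i n
      (DP.mulMono p (height S R) K (levelExp i (p ^ S i - 1) (p ^ R i - 1) (p ^ R i - 1)) * a) := by
  have hN := two_le_prime_pow (p := p) hS
  have hM := two_le_prime_pow (p := p) hR
  induction h with
  | base =>
    intro n hn
    rw [← lie_vEnd_pow_uEnd_eq hS]
    have h1 := (IdealReach.base (K := K) (X := gensAt p K S R i)
      (c := adMap K (vEnd p K S R i) (uEnd p K S R i))).lie_pow (x := vEnd p K S R i)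
      (by simp [gensAt]) (p ^ S i - 1)
    rw [← Module.End.mul_apply, ← pow_succ, Nat.sub_add_cancel (by omega)] at h1
    exact h1.mono (by omega)
  | add _ _ ha hb =>
    intro n hn
    rw [mul_add]
    exact (ha n hn).add (hb n hn)
  | smul d _ ha =>
    intro n hn
    rw [mul_smul_comm]
    exact (ha n hn).smul d
  | @lie m x a hx ha ih =>
    intro n hn
    have h2 := ha.two_le
    have h3 : (p ^ S i + p ^ R i - 1) * 2 ≤ (p ^ S i + p ^ R i - 1) * m :=
      Nat.mul_le_mul_left _ h2
    rw [mul_add, mul_one] at hn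
    -- The subtraction is not truncated: m ≥ 2 and D ≤ 2μ force n ≥ μ.
    have h4 := ih (n - (p ^ S i + p ^ R i - 1)) (by omega)
    have h5 := h4.lie_of_lieReach (lieReach_gensAt_succ hS hR hx)
    have h6 := levelCentralizer_commute_mulMono (gensAt_subset (Nat.lt_succ_self i) hx)
      (α := levelExp i (p ^ S i - 1) (p ^ R i - 1) (p ^ R i - 1)) fun _ => levelExp_eq_zero
    have h7 : adMap K x (DP.mulMono p (height S R) K
        (levelExp i (p ^ S i - 1) (p ^ R i - 1) (p ^ R i - 1)) * a) =
        DP.mulMono p (height S R) K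
          (levelExp i (p ^ S i - 1) (p ^ R i - 1) (p ^ R i - 1)) * adMap K x a := by
      simp only [LinearMap.sub_apply, LinearMap.mulLeft_apply, LinearMap.mulRight_apply]
      rw [← mul_assoc, h6.eq, mul_sub, mul_assoc, mul_assoc]
    rw [h7] at h5
    exact h5.mono (by omega)
  | mono hmn _ ih =>
    intro n hn
    exact ih n ((Nat.mul_le_mul_left _ hmn).trans hn)

/-- Lowering the top monomial to the given one takes at most its full degree in extra brackets,
exactly the amount saved in `IdealAt.mulMono_top`. -/
theorem IdealAt.mulMono (hS : 0 < S i) (hR : 0 < R i) {m : ℕ} {f : Module.End K (Alg p K S R)}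
    (h : IdealAt p K S R (i + 1) m f) {a b c : ℕ} (ha : a < p ^ S i) (hb : b < p ^ R i)
    (hc : c < p ^ R i) : IdealAt p K S R i ((p ^ S i + p ^ R i - 1) * m)
      (DP.mulMono p (height S R) K (levelExp i a b c) * f) := by
  have hN := two_le_prime_pow (p := p) hS
  have hM := two_le_prime_pow (p := p) hR
  have h2 : (p ^ S i + p ^ R i - 1) * 2 ≤ (p ^ S i + p ^ R i - 1) * m :=
    Nat.mul_le_mul_left _ h.two_le
  have hf := h.mem_cent (Nat.lt_succ_self i)
  have h1 := h.mulMono_top hS hR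
    ((p ^ S i + p ^ R i - 1) * m - (p ^ S i + 2 * p ^ R i - 3)) (by omega)
  have h3 := ((h1.lie_pow (x := vEnd p K S R i) (by simp [gensAt]) (p ^ S i - 1 - a)).lie_pow
    (x := wEnd p K S R i) (by simp [gensAt]) (p ^ R i - 1 - b)).lie_pow
    (x := uEnd p K S R i) (by simp [gensAt]) (p ^ R i - 1 - c)
  have e1 := lower_x hf (a := a) (b := p ^ R i - 1) (c := p ^ R i - 1) (j := p ^ S i - 1 - a)
    (by omega)
  have e2 := lower_y hf (a := a) (b := b) (c := p ^ R i - 1) (j := p ^ R i - 1 - b) (by omega)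
  have e3 := lower_z hf (a := a) (b := b) (c := c) (j := p ^ R i - 1 - c) (by omega)
  rw [show a + (p ^ S i - 1 - a) = p ^ S i - 1 by omega] at e1
  rw [show b + (p ^ R i - 1 - b) = p ^ R i - 1 by omega] at e2
  rw [show c + (p ^ R i - 1 - c) = p ^ R i - 1 by omega] at e3
  rw [e1, e2, e3] at h3
  exact h3.mono (by omega)

end Lower

end Clover

/-- Elements of the ideal are built by bracketing with generators on the left, so they are
combinations of right-normed commutators and no p-th powers are needed. -/
theorem IdealReach.exists_mem_growthSpace {K : Type*} [Field K] {p : ℕ} {A : Type*} [Ring A]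
    [Algebra K A] {L : RestrictedLieSubalgebra K p A} {X : Set L.toLieSubalgebra} {Y : Set A}
    (hY : ∀ y ∈ Y, ∃ x ∈ X, x.1 = y) {y z : A} (hy : y ∈ Y) (hz : z ∈ Y) {n : ℕ} {a : A}
    (h : IdealReach K Y (adMap K y z) n a) : ∃ b ∈ growthSpace L X n, b.1 = a := by
  have key : ∃ b ∈ Submodule.span K {b : L.toLieSubalgebra | ∃ l : List L.toLieSubalgebra,
      l ≠ [] ∧ (∀ x ∈ l, x ∈ X) ∧ l.length ≤ n ∧ b = rightNormed l}, b.1 = a := by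
    induction h with
    | base =>
      obtain ⟨y', hy', rfl⟩ := hY y hy
      obtain ⟨z', hz', rfl⟩ := hY z hz
      exact ⟨⁅y', z'⁆, Submodule.subset_span ⟨[y', z'], by simp, by simp [hy', hz'], by simp, rfl⟩,
        rfl⟩
    | add _ _ ha hb =>
      obtain ⟨a, ha, rfl⟩ := ha
      obtain ⟨b, hb, rfl⟩ := hb
      exact ⟨a + b, add_mem ha hb, rfl⟩
    | smul d _ ha =>
      obtain ⟨a, ha, rfl⟩ := ha
      exact ⟨d • a, Submodule.smul_mem _ d ha, rfl⟩
    | @lie n x a hx h ha =>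
      obtain ⟨a, ha, rfl⟩ := ha
      obtain ⟨x, hx', rfl⟩ := hY x hx
      refine ⟨⁅x, a⁆, ?_, rfl⟩
      clear h
      induction ha using Submodule.span_induction with
      | zero => simp
      | add a b _ _ ha hb =>
        rw [lie_add]
        exact add_mem ha hb
      | smul d a _ ha =>
        rw [lie_smul]
        exact Submodule.smul_mem _ d ha
      | mem a ha =>
        obtain ⟨l, hl, hlX, hn, rfl⟩ := ha
        refine Submodule.subset_span ⟨x :: l, by simp, ?_, by simpa using hn, ?_⟩
        · intro z hz
          rcases List.mem_cons.1 hz with rfl | hz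
          exacts [hx', hlX z hz]
        -- Nonemptiness matters: bracketing x with the empty commutator gives 0, while the list [x]
        -- represents x.
        · cases l with
          | nil => exact absurd rfl hl
          | cons y l => rfl
    | mono hmn _ ha =>
      obtain ⟨a, ha, rfl⟩ := ha
      refine ⟨a, Submodule.span_mono ?_ ha, rfl⟩
      rintro b ⟨l, h1, h2, h3, rfl⟩
      exact ⟨l, h1, h2, h3.trans hmn, rfl⟩
  obtain ⟨b, hb, rfl⟩ := key
  refine ⟨b, Submodule.span_mono ?_ hb, rfl⟩
  rintro b ⟨l, h1, h2, h3, rfl⟩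
  exact ⟨l, 0, h1, h2, by simpa using h3, rfl⟩

theorem RestrictedLieSubalgebra.mem_lieSpan {K : Type*} [Field K] {p : ℕ} {A : Type*} [Ring A]
    [Algebra K A] {X : Set A} {a : A} (ha : a ∈ X) :
    a ∈ (RestrictedLieSubalgebra.lieSpan K p X).toLieSubalgebra := by
  change a ∈ sInf {L : LieSubalgebra K A | X ⊆ L ∧ ∀ a ∈ L, a ^ p ∈ L}
  rw [← SetLike.mem_coe, LieSubalgebra.coe_sInf, Set.mem_iInter₂]
  exact fun L hL => hL.1 ha

/-! ### Counting independent elements for the lower bound -/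

namespace Clover

section LowerCount

/-- The exponent of a product of monomials in the variables of the levels `i, …, i + k - 1`. -/
noncomputable def multiExp (e : ℕ → ℕ × ℕ × ℕ) (i k : ℕ) : CloverVar →₀ ℕ :=
  ∑ j ∈ Finset.range k, levelExp (i + j) (e (i + j)).1 (e (i + j)).2.1 (e (i + j)).2.2

theorem multiExp_succ (e : ℕ → ℕ × ℕ × ℕ) (i k : ℕ) : multiExp e i (k + 1) =
    levelExp i (e i).1 (e i).2.1 (e i).2.2 + multiExp e (i + 1) k := by
  rw [multiExp, Finset.sum_range_succ', add_comm]
  rw [add_zero, multiExp]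
  congr 1
  refine Finset.sum_congr rfl fun j _ => ?_
  rw [show i + (j + 1) = i + 1 + j by omega]

theorem multiExp_eq_zero (e : ℕ → ℕ × ℕ × ℕ) {i k : ℕ} {t : CloverVar}
    (h : ∀ j, i ≤ j → j < i + k → t ∉ level j) : multiExp e i k t = 0 := by
  rw [multiExp, Finsupp.finsetSum_apply]
  refine Finset.sum_eq_zero fun j hj => levelExp_eq_zero (h _ (Nat.le_add_right _ _) ?_)
  have := Finset.mem_range.1 hj
  omega

theorem notMem_level {i j : ℕ} (h : i ≠ j) {t : CloverVar} (ht : t ∈ level i) : t ∉ level j := by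
  rcases ht with rfl | rfl | rfl <;> simp [level, h]

theorem multiExp_apply (e : ℕ → ℕ × ℕ × ℕ) {i k j : ℕ} (h1 : i ≤ j) (h2 : j < i + k)
    {t : CloverVar} (ht : t ∈ level j) :
    multiExp e i k t = levelExp j (e j).1 (e j).2.1 (e j).2.2 t := by
  rw [multiExp, Finsupp.finsetSum_apply, Finset.sum_eq_single (j - i)]
  · rw [show i + (j - i) = j by omega]
  · intro l _ hl
    exact levelExp_eq_zero (notMem_level (by omega) ht)
  · intro h
    exact absurd (Finset.mem_range.2 (by omega)) h

variable {p : ℕ} {K : Type*} [Field K] [Fact p.Prime] [CharP K p] {s r : ℕ}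

theorem IdealAt.multi (hs : 0 < s) (hr : 0 < r) {e : ℕ → ℕ × ℕ × ℕ}
    (he : ∀ j, (e j).1 < p ^ s ∧ (e j).2.1 < p ^ r ∧ (e j).2.2 < p ^ r) (k : ℕ) : ∀ i : ℕ,
    IdealAt p K (fun _ => s) (fun _ => r) i (2 * (p ^ s + p ^ r - 1) ^ k)
      (DP.mulMono p (height (fun _ => s) (fun _ => r)) K (multiExp e i k) *
        adMap K (vEnd p K (fun _ => s) (fun _ => r) (i + k))
          (uEnd p K (fun _ => s) (fun _ => r) (i + k))) := by
  induction k with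
  | zero =>
    intro i
    rw [multiExp, Finset.sum_range_zero, DP.mulMono_zero, one_mul, pow_zero, mul_one, add_zero]
    exact .base
  | succ k ih =>
    intro i
    have h1 := IdealAt.mulMono (S := fun _ => s) (R := fun _ => r) hs hr (ih (i + 1)) (he i).1
      (he i).2.1 (he i).2.2
    rw [← mul_assoc (DP.mulMono _ _ _ _), DP.mulMono_mul_of_disjoint, ← multiExp_succ,
      add_right_comm, add_assoc] at h1
    · rw [pow_succ]
      convert h1 using 1
      ring
    · intro t
      by_cases ht : t ∈ level i
      · exact Or.inr (multiExp_eq_zero e fun j hj _ => notMem_level (by omega) ht)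
      · exact Or.inl (levelExp_eq_zero ht)

/-- The tail contributes nothing because u_{k+1} kills z_k. Evaluation at this variable strips the
last pivot from an operator. -/
theorem uEnd_apply_z {S R : ℕ → ℕ} (k : ℕ) (hR : 0 < R k) : uEnd p K S R k
    (DP.mono p (height S R) K (Finsupp.single (.z k) 1)) = 1 := by
  have hM := two_le_prime_pow (p := p) hR
  have h1 : ∀ t, (Finsupp.single (CloverVar.z k) 1 : CloverVar →₀ ℕ) t < p ^ height S R t := by
    intro t
    by_cases ht : CloverVar.z k = t
    · subst ht
      simp [height]
      omega
    · simpa [ht] using pow_pos (Fact.out : p.Prime).pos _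
  have h2 : uEnd p K S R (k + 1) (DP.mono p (height S R) K (Finsupp.single (.z k) 1)) = 0 := by
    have h3 := levelCentralizer_commute_mulMono (uEnd_mem (p := p) (K := K) (S := S) (R := R)
      (Nat.lt_succ_self k)) (α := Finsupp.single (.z k) 1)
      fun t ht => single_eq_zero_of_level (by simp [level]) ht 1
    have h4 := congrArg (fun F => F 1) h3.eq
    have h5 : uEnd p K S R (k + 1) 1 = 0 := (u p K S R (k + 1)).map_one_eq_zero
    simpa [DP.mulMono, h5] using h4
  have h3 := DP.partialMap_mono (K := K) (.z k) ⟨_, h1⟩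
  rw [uEnd_eq, LinearMap.add_apply, Module.End.mul_apply, h2, map_zero, add_zero]
  refine h3.trans ?_
  rw [if_neg (by simp), tsub_self]
  rfl

/-- The operators (monomial in levels below k) · [v_k, u_k] have degree at most 2μ^k. Evaluated at
z_{k+1}, they give distinct basis monomials with the common factor x_k^(p^s - 2) z_k^(p^r - 1). -/
theorem le_growth (hs : 0 < s) (hr : 0 < r) (k : ℕ) : (p ^ (s + 2 * r)) ^ k ≤
    growth (T p K (fun _ => s) (fun _ => r)) (genSet p K (fun _ => s) (fun _ => r))
      (2 * (p ^ s + p ^ r - 1) ^ k) := by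
  have hN := two_le_prime_pow (p := p) hs
  have hM := two_le_prime_pow (p := p) hr
  set n := 2 * (p ^ s + p ^ r - 1) ^ k with hn
  set V := growthSpace (T p K (fun _ => s) (fun _ => r)) (genSet p K (fun _ => s) (fun _ => r)) n
  -- Without finite dimensionality `finrank` would be 0 by convention. Any large exponent serves in
  -- the upper bound.
  have hfin : FiniteDimensional K V := by
    refine (growth_le (k := n * (p ^ s + p ^ r - 2)) hs hr ?_).1
    have h1 : n * (p ^ s + p ^ r - 2) < (p ^ s + p ^ r - 1) ^ (n * (p ^ s + p ^ r - 2)) :=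
      Nat.lt_pow_self (by omega)
    have h2 := Nat.mul_le_mul_right ((p ^ s + p ^ r - 1) ^ (n * (p ^ s + p ^ r - 2)))
      (show 1 ≤ p ^ s - 1 by omega)
    omega
  let ι := Fin k → Fin (p ^ s) × Fin (p ^ r) × Fin (p ^ r)
  let E (f : ι) (j : ℕ) : ℕ × ℕ × ℕ :=
    if h : j < k then ((f ⟨j, h⟩).1, (f ⟨j, h⟩).2.1, (f ⟨j, h⟩).2.2) else (0, 0, 0)
  have hE (f : ι) (j : ℕ) : (E f j).1 < p ^ s ∧ (E f j).2.1 < p ^ r ∧ (E f j).2.2 < p ^ r := by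
    by_cases h : j < k
    · simp [E, h]
    · simp [E, h, (Fact.out : p.Prime).pos]
  let Y := DP.mono p (height (fun _ => s) (fun _ => r)) K (Finsupp.single (.z (k + 1)) 1)
  let tail := levelExp k (p ^ s - 2) 0 (p ^ r - 1)
  have hmem (f : ι) : ∃ b ∈ V, b.1 Y =
      DP.mono p (height (fun _ => s) (fun _ => r)) K (multiExp (E f) 0 k + tail) := by
    have h1 := IdealAt.multi (K := K) hs hr (hE f) k 0
    obtain ⟨b, hb, hb'⟩ := h1.exists_mem_growthSpace (L := T p K (fun _ => s) (fun _ => r))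
      (X := genSet p K (fun _ => s) (fun _ => r)) (fun y hy => ⟨⟨y, RestrictedLieSubalgebra.mem_lieSpan hy⟩, hy, rfl⟩)
      (Or.inl rfl) (Or.inr (Or.inr rfl))
    refine ⟨b, hb, ?_⟩
    have h2 := lie_vEnd_pow_uEnd (p := p) (K := K) (S := fun _ => s) (R := fun _ => r) (i := k)
      (j := 1) le_rfl (by omega)
    rw [pow_one] at h2
    rw [hb', zero_add, h2, ← mul_assoc, DP.mulMono_mul_of_disjoint, Module.End.mul_apply,
      uEnd_apply_z _ hr]
    · change DP.mono p _ K _ * (1 : Alg p K _ _) = _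
      rw [mul_one, Nat.sub_sub]
    · intro t
      by_cases ht : t ∈ level k
      · exact Or.inl (multiExp_eq_zero _ fun j _ hj => notMem_level (by omega) ht)
      · exact Or.inr (levelExp_eq_zero ht)
  choose b hb hbY using hmem
  have hrange (f : ι) : ∀ t, (multiExp (E f) 0 k + tail) t <
      p ^ height (fun _ => s) (fun _ => r) t := by
    intro t
    rw [Finsupp.add_apply]
    have hlev : ∃ j, t ∈ level j := by
      cases t with
      | x j => exact ⟨j, by simp [level]⟩
      | y j => exact ⟨j, by simp [level]⟩
      | z j => exact ⟨j, by simp [level]⟩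
    obtain ⟨j, hj⟩ := hlev
    by_cases hjk : j < k
    · rw [multiExp_apply _ (Nat.zero_le j) (by omega) hj,
        show tail t = 0 from levelExp_eq_zero (notMem_level (by omega) hj), add_zero]
      rcases hj with rfl | rfl | rfl <;> simp [height, (hE f j)]
    · rw [multiExp_eq_zero _ fun l _ hl => notMem_level (by omega) hj, zero_add]
      by_cases hjk' : j = k
      · subst hjk'
        rcases hj with rfl | rfl | rfl <;> simp [height, tail] <;> omega
      · rw [show tail t = 0 from levelExp_eq_zero (notMem_level hjk' hj)]
        exact pow_pos (Fact.out : p.Prime).pos _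
  have hinj : Function.Injective fun f : ι =>
      (⟨multiExp (E f) 0 k + tail, hrange f⟩ : DPExp p (height (fun _ => s) (fun _ => r))) := by
    intro f g hfg
    have h1 := add_right_cancel (Subtype.ext_iff.1 hfg)
    funext j
    have h2 (t : CloverVar) (ht : t ∈ level j) := DFunLike.congr_fun h1 t
    have hx := h2 (.x j) (by simp [level])
    have hy := h2 (.y j) (by simp [level])
    have hz := h2 (.z j) (by simp [level])
    rw [multiExp_apply _ (Nat.zero_le _) (by simp) (by simp [level] : _ ∈ level (j : ℕ)),
      multiExp_apply _ (Nat.zero_le _) (by simp) (by simp [level] : _ ∈ level (j : ℕ))]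
      at hx hy hz
    simp only [levelExp_x, levelExp_y, levelExp_z, E, j.2, dif_pos, Fin.eta] at hx hy hz
    exact Prod.ext (Fin.ext hx) (Prod.ext (Fin.ext hy) (Fin.ext hz))
  have hli : LinearIndependent K fun f : ι => (⟨b f, hb f⟩ : V) := by
    let ev : V →ₗ[K] Alg p K (fun _ => s) (fun _ => r) :=
      LinearMap.applyₗ Y ∘ₗ (T p K (fun _ => s) (fun _ => r)).toLieSubalgebra.toSubmodule.subtype ∘ₗ
        V.subtype
    refine LinearIndependent.of_comp ev ?_
    have h1 := (DP.basis p (height (fun _ => s) (fun _ => r)) K).linearIndependent.comp _ hinj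
    have e : (ev ∘ fun f : ι => (⟨b f, hb f⟩ : V)) =
        (DP.basis p (height (fun _ => s) (fun _ => r)) K) ∘ fun f : ι =>
          ⟨multiExp (E f) 0 k + tail, hrange f⟩ :=
      funext fun f => (hbY f).trans (DP.basis_eq ⟨_, hrange f⟩).symm
    rw [e]
    exact h1
  have hcard := hli.fintype_card_le_finrank
  refine le_trans (le_of_eq ?_) hcard
  simp only [ι, Fintype.card_pi, Fintype.card_prod, Fintype.card_fin, Finset.prod_const,
    Finset.card_univ]
  congr 1
  ring

end LowerCount

end Clover

/-! ### From growth estimates to the dimension -/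

open Real in
/-- The upper growth exponent of a function squeezed between multiples of `n ^ (log_μ q)`, the lower
bound being given along a subsequence. -/
theorem limsup_log_div_log_eq {γ : ℕ → ℕ} {μ q : ℕ} (hμ : 2 ≤ μ) (hq : 2 ≤ q)
    (hup : ∀ n, γ n ≤ 5 * q ^ (Nat.log μ n + 2)) (hlow : ∀ k, q ^ k ≤ γ (2 * μ ^ k)) :
    limsup (fun n : ℕ => ((log (γ n) / log n : ℝ) : EReal)) atTop =
      ((log q / log μ : ℝ) : EReal) := by
  have hlμ : 0 < log μ := log_pos (by exact_mod_cast (by omega : 1 < μ))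
  have hlq : 0 < log q := log_pos (by exact_mod_cast (by omega : 1 < q))
  have hlog : Tendsto (fun n : ℕ => log (n : ℝ)) atTop atTop :=
    tendsto_log_atTop.comp tendsto_natCast_atTop_atTop
  refine le_antisymm ?_ ?_
  · set C := log 5 + 2 * log q with hC
    have hC0 : 0 ≤ C := add_nonneg (log_nonneg (by norm_num)) (by positivity)
    have hlim : Tendsto (fun n : ℕ => ((C / log n + log q / log μ : ℝ) : EReal)) atTop
        (nhds ((log q / log μ : ℝ) : EReal)) := by
      refine (continuous_coe_real_ereal.tendsto _).comp ?_
      simpa using (hlog.const_div_atTop C).add_const (log q / log μ)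
    rw [← hlim.limsup_eq]
    refine limsup_le_limsup ?_
    filter_upwards [eventually_ge_atTop 2] with n hn
    refine EReal.coe_le_coe_iff.2 ?_
    have hln : 0 < log (n : ℝ) := log_pos (by exact_mod_cast (by omega : 1 < n))
    have h1 := hup n
    have h2 : log (γ n) ≤ C + Nat.log μ n * log q := by
      -- If γ n = 0, the convention log 0 = 0 still gives the bound.
      rcases Nat.eq_zero_or_pos (γ n) with h0 | h0
      · rw [h0, Nat.cast_zero, log_zero]
        positivity
      · have h3 : log (γ n) ≤ log (5 * (q : ℝ) ^ (Nat.log μ n + 2)) :=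
          log_le_log (by exact_mod_cast h0) (by exact_mod_cast h1)
        have hq0 : (q : ℝ) ≠ 0 := by exact_mod_cast (by omega : q ≠ 0)
        rw [log_mul (by norm_num) (pow_ne_zero _ hq0), log_pow] at h3
        push_cast at h3
        rw [hC]
        linarith
    have h3 : Nat.log μ n * log μ ≤ log n := by
      rw [← log_pow]
      refine log_le_log (by positivity) ?_
      exact_mod_cast Nat.pow_log_le_self μ (by omega)
    rw [div_add_div _ _ hln.ne' hlμ.ne', div_le_div_iff₀ hln (by positivity)]
    have h4 : log (γ n) * log μ ≤ C * log μ + log n * log q := by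
      nlinarith [mul_le_mul_of_nonneg_right h2 hlμ.le, mul_le_mul_of_nonneg_right h3 hlq.le]
    nlinarith [mul_le_mul_of_nonneg_right h4 hln.le]
  · have hφ : Tendsto (fun k : ℕ => 2 * μ ^ k) atTop atTop :=
      tendsto_atTop_mono (fun k => by
        have := (Nat.lt_pow_self (n := k) (show 1 < μ by omega)).le
        show k ≤ _
        omega) tendsto_id
    have hlim : Tendsto (fun k : ℕ => ((k * log q / (log 2 + k * log μ) : ℝ) : EReal)) atTop
        (nhds ((log q / log μ : ℝ) : EReal)) := by
      refine (continuous_coe_real_ereal.tendsto _).comp ?_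
      have h1 : Tendsto (fun k : ℕ => log q / (log 2 / (k : ℝ) + log μ)) atTop
          (nhds (log q / (0 + log μ))) :=
        tendsto_const_nhds.div
          ((tendsto_natCast_atTop_atTop.const_div_atTop (log 2)).add_const _)
          (by rw [zero_add]; exact hlμ.ne')
      rw [zero_add] at h1
      refine h1.congr' ?_
      filter_upwards [eventually_gt_atTop 0] with k hk
      have hk' : (k : ℝ) ≠ 0 := by exact_mod_cast hk.ne'
      have hk0 : 0 < (k : ℝ) := by exact_mod_cast hk
      have : 0 < log 2 := log_pos (by norm_num)
      field_simp
    rw [← hlim.limsup_eq]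
    -- A limsup is at least the limsup along the degrees 2μ^k, so no bound between them is needed.
    refine le_trans (limsup_le_limsup ?_) (limsup_le_limsup_of_le hφ)
    filter_upwards [eventually_gt_atTop 0] with k hk
    refine EReal.coe_le_coe_iff.2 ?_
    have h0 := hlow k
    have h1 : k * log q ≤ log (γ (2 * μ ^ k)) := by
      rw [← log_pow]
      refine log_le_log (pow_pos (by exact_mod_cast (by omega : 0 < q)) _) ?_
      exact_mod_cast h0
    have h2 : log ((2 * μ ^ k : ℕ) : ℝ) = log 2 + k * log μ := by
      push_cast
      rw [log_mul (by norm_num) (pow_ne_zero _ (by exact_mod_cast (by omega : μ ≠ 0))), log_pow]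
    change _ ≤ log (γ (2 * μ ^ k)) / log ((2 * μ ^ k : ℕ) : ℝ)
    rw [h2]
    refine div_le_div_of_nonneg_right h1 ?_
    have : 0 < log 2 := log_pos (by norm_num)
    positivity

/-! ### The dimension formula, its range and the density of its values -/

namespace Clover

section Dimension

variable (p : ℕ) (K : Type*) [Field K] [Fact p.Prime] [CharP K p]

open Real in
theorem gkDimConst_eq {s r : ℕ} (hs : 0 < s) (hr : 0 < r) : gkDimConst p K s r =
    ((log ((p : ℝ) ^ (s + 2 * r)) / log ((p : ℝ) ^ s + (p : ℝ) ^ r - 1) : ℝ) : EReal) := by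
  have hN := two_le_prime_pow (p := p) hs
  have hM := two_le_prime_pow (p := p) hr
  have hμR : (p : ℝ) ^ s + (p : ℝ) ^ r - 1 = ((p ^ s + p ^ r - 1 : ℕ) : ℝ) := by
    rw [Nat.cast_sub (by omega)]
    push_cast
    rfl
  rw [hμR, ← Nat.cast_pow]
  refine limsup_log_div_log_eq (by omega) (two_le_prime_pow (by omega)) (fun n => ?_)
    fun k => le_growth hs hr k
  -- The exponent log_μ n + 2 suffices because n < μ^(log_μ n + 1) and the left side is at most nμ.
  refine (growth_le hs hr ?_).2
  generalize hμ : p ^ s + p ^ r - 1 = μ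
  have h2 := Nat.lt_pow_succ_log_self (show 1 < μ by omega) n
  have h3 : n * (p ^ s + p ^ r - 2) ≤ n * μ := Nat.mul_le_mul_left _ (by omega)
  have h4 : n * μ ≤ μ ^ (Nat.log μ n + 2) := by
    rw [pow_succ]
    exact Nat.mul_le_mul_right _ h2.le
  have h5 := Nat.mul_le_mul_right (μ ^ (Nat.log μ n + 2)) (show 1 ≤ p ^ s - 1 by omega)
  omega

open Real in
-- With N = p^s, M = p^r, μ = N + M - 1: N M² ≥ μ since N, M ≥ 2, and N M² ≤ μ³ since each of the
-- three factors is at most μ.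
theorem gkDimConst_mem_Icc {s r : ℕ} (hs : 0 < s) (hr : 0 < r) :
    gkDimConst p K s r ∈ Set.Icc (1 : EReal) 3 := by
  have hp2 : (2 : ℝ) ≤ p := by exact_mod_cast (Fact.out : p.Prime).two_le
  have hN : (2 : ℝ) ≤ (p : ℝ) ^ s := by exact_mod_cast two_le_prime_pow (p := p) hs
  have hM : (2 : ℝ) ≤ (p : ℝ) ^ r := by exact_mod_cast two_le_prime_pow (p := p) hr
  have hμ : 0 < log ((p : ℝ) ^ s + (p : ℝ) ^ r - 1) := log_pos (by linarith)
  have e : (p : ℝ) ^ (s + 2 * r) = (p : ℝ) ^ s * (p : ℝ) ^ r * (p : ℝ) ^ r := by ring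
  rw [gkDimConst_eq p K hs hr]
  refine ⟨?_, ?_⟩
  · rw [← EReal.coe_one]
    refine EReal.coe_le_coe_iff.2 ((one_le_div hμ).2 (log_le_log (by linarith) ?_))
    rw [e]
    nlinarith [mul_nonneg (sub_nonneg.2 hN) (sub_nonneg.2 hM)]
  · have : (3 : EReal) = ((3 : ℝ) : EReal) := rfl
    rw [this]
    refine EReal.coe_le_coe_iff.2 ((div_le_iff₀ hμ).2 ?_)
    have h3 : (3 : ℝ) * log ((p : ℝ) ^ s + (p : ℝ) ^ r - 1) =
        log (((p : ℝ) ^ s + (p : ℝ) ^ r - 1) ^ 3) := by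
      rw [log_pow]
      norm_num
    rw [h3]
    refine log_le_log (by positivity) ?_
    rw [e, pow_succ, pow_two]
    exact mul_le_mul (mul_le_mul (by linarith) (by linarith) (by linarith) (by linarith))
      (by linarith) (by linarith) (mul_self_nonneg _)

open Real in
-- Set c = (d - 1)/2 ∈ [0,1] and m = ⌊cn⌋ ≤ n. Then p^(n+1) ≤ μ ≤ p^(n+2), so the quotient lies
-- between (n + 2m + 3)/(n + 2) and (n + 2m + 3)/(n + 1), both tending to 1 + 2c = d.
theorem tendsto_gkDimConst {d : ℝ} (hd1 : 1 ≤ d) (hd3 : d ≤ 3) :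
    Tendsto (fun n : ℕ => gkDimConst p K (n + 1) (⌊(d - 1) / 2 * n⌋₊ + 1)) atTop
      (nhds (d : EReal)) := by
  have hp2 : (2 : ℝ) ≤ p := by exact_mod_cast (Fact.out : p.Prime).two_le
  have hlp : 0 < log p := log_pos (by linarith)
  set c := (d - 1) / 2 with hc
  have hc0 : 0 ≤ c := by linarith
  have hc1 : c ≤ 1 := by linarith
  simp_rw [gkDimConst_eq p K (Nat.succ_pos _) (Nat.succ_pos _)]
  refine (continuous_coe_real_ereal.tendsto _).comp ?_
  have hfl (n : ℕ) : (⌊c * n⌋₊ : ℝ) ≤ c * n ∧ c * n < ⌊c * n⌋₊ + 1 :=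
    ⟨Nat.floor_le (by positivity), Nat.lt_floor_add_one _⟩
  have hfn (n : ℕ) : ⌊c * n⌋₊ ≤ n := by
    have := (hfl n).1
    have h2 : (⌊c * n⌋₊ : ℝ) ≤ n := by nlinarith [Nat.cast_nonneg (α := ℝ) n]
    exact_mod_cast h2
  have hlow : Tendsto (fun n : ℕ => (1 + 2 * c) - (1 + 2 * c) * 2 / ((n : ℝ) + 2)) atTop (nhds d) := by
    have h1 : Tendsto (fun n : ℕ => (n : ℝ) + 2) atTop atTop :=
      tendsto_atTop_add_const_right _ _ tendsto_natCast_atTop_atTop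
    have h2 := (h1.const_div_atTop ((1 + 2 * c) * 2)).const_sub (1 + 2 * c)
    have e : 1 + 2 * c - 0 = d := by rw [hc]; ring
    rwa [e] at h2
  have hhigh : Tendsto (fun n : ℕ => (1 + 2 * c) + 2 / ((n : ℝ) + 1)) atTop (nhds d) := by
    have h1 : Tendsto (fun n : ℕ => (n : ℝ) + 1) atTop atTop :=
      tendsto_atTop_add_const_right _ _ tendsto_natCast_atTop_atTop
    have h2 := (h1.const_div_atTop 2).const_add (1 + 2 * c)
    have e : 1 + 2 * c + 0 = d := by rw [hc]; ring
    rwa [e] at h2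
  refine tendsto_of_tendsto_of_tendsto_of_le_of_le hlow hhigh (fun n => ?_) fun n => ?_
  all_goals
    set m := ⌊c * n⌋₊
    have hm := hfl n
    have hm' : (p : ℝ) ^ (m + 1) ≤ (p : ℝ) ^ (n + 1) :=
      pow_le_pow_right₀ (by linarith) (Nat.succ_le_succ (hfn n))
    have hN : (2 : ℝ) ≤ (p : ℝ) ^ (n + 1) := by exact_mod_cast two_le_prime_pow (Nat.succ_pos n)
    have hM : (2 : ℝ) ≤ (p : ℝ) ^ (m + 1) := by exact_mod_cast two_le_prime_pow (Nat.succ_pos m)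
    have hμ : 0 < log ((p : ℝ) ^ (n + 1) + (p : ℝ) ^ (m + 1) - 1) := log_pos (by linarith)
    have hμ1 : ((n : ℝ) + 1) * log p ≤ log ((p : ℝ) ^ (n + 1) + (p : ℝ) ^ (m + 1) - 1) := by
      have := log_le_log (by linarith) (show (p : ℝ) ^ (n + 1) ≤
        (p : ℝ) ^ (n + 1) + (p : ℝ) ^ (m + 1) - 1 by linarith)
      rw [log_pow] at this
      push_cast at this
      exact this
    have hμ2 : log ((p : ℝ) ^ (n + 1) + (p : ℝ) ^ (m + 1) - 1) ≤ ((n : ℝ) + 2) * log p := by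
      have := log_le_log (by linarith) (show (p : ℝ) ^ (n + 1) + (p : ℝ) ^ (m + 1) - 1 ≤
        (p : ℝ) ^ (n + 2) by rw [pow_succ _ (n + 1)]; nlinarith)
      conv_rhs at this => rw [log_pow]
      push_cast at this
      exact this
    have e : log ((p : ℝ) ^ (n + 1 + 2 * (m + 1))) = ((n : ℝ) + 2 * m + 3) * log p := by
      rw [log_pow]
      push_cast
      ring
    rw [e]
    have hn0 : (0 : ℝ) ≤ n := Nat.cast_nonneg n
  · rw [le_div_iff₀ hμ]
    have h1 : (1 + 2 * c - (1 + 2 * c) * 2 / ((n : ℝ) + 2)) * ((n : ℝ) + 2) ≤ n + 2 * m + 3 := by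
      rw [sub_mul, div_mul_cancel₀ _ (by positivity)]
      nlinarith
    have h0 : 0 ≤ 1 + 2 * c - (1 + 2 * c) * 2 / ((n : ℝ) + 2) := by
      rw [sub_nonneg, div_le_iff₀ (by positivity)]
      nlinarith
    calc _ ≤ (1 + 2 * c - (1 + 2 * c) * 2 / ((n : ℝ) + 2)) * (((n : ℝ) + 2) * log p) :=
          mul_le_mul_of_nonneg_left hμ2 h0
      _ = (1 + 2 * c - (1 + 2 * c) * 2 / ((n : ℝ) + 2)) * ((n : ℝ) + 2) * log p := by ring
      _ ≤ _ := mul_le_mul_of_nonneg_right h1 hlp.le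
  · rw [div_le_iff₀ hμ]
    have h1 : (n : ℝ) + 2 * m + 3 ≤ (1 + 2 * c + 2 / ((n : ℝ) + 1)) * ((n : ℝ) + 1) := by
      rw [add_mul, div_mul_cancel₀ _ (by positivity)]
      nlinarith
    calc _ ≤ (1 + 2 * c + 2 / ((n : ℝ) + 1)) * ((n : ℝ) + 1) * log p :=
          mul_le_mul_of_nonneg_right h1 hlp.le
      _ = (1 + 2 * c + 2 / ((n : ℝ) + 1)) * (((n : ℝ) + 1) * log p) := by ring
      _ ≤ _ := mul_le_mul_of_nonneg_left hμ1 (by positivity)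

end Dimension

end Clover

theorem corollary5p5 (p : ℕ) [Fact p.Prime] (K : Type*) [Field K] [CharP K p] :
    {d : EReal | ∃ S R : ℕ, 0 < S ∧ 0 < R ∧ d = Clover.gkDimConst p K S R} ⊆ Set.Icc 1 3 ∧
    Set.Icc 1 3 ⊆
      closure {d : EReal | ∃ S R : ℕ, 0 < S ∧ 0 < R ∧ d = Clover.gkDimConst p K S R} := by
  refine ⟨?_, fun d hd => ?_⟩
  · rintro d ⟨s, r, hs, hr, rfl⟩
    exact Clover.gkDimConst_mem_Icc p K hs hr
  · have hbot : d ≠ ⊥ := (lt_of_lt_of_le (EReal.bot_lt_coe 1) hd.1).ne'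
    have htop : d ≠ ⊤ := (lt_of_le_of_lt hd.2 (EReal.coe_lt_top 3)).ne
    lift d to ℝ using ⟨htop, hbot⟩
    have h1 : (1 : ℝ) ≤ d := EReal.coe_le_coe_iff.1 hd.1
    have h3 : d ≤ 3 := EReal.coe_le_coe_iff.1 hd.2
    exact mem_closure_of_tendsto (Clover.tendsto_gkDimConst p K h1 h3)
      (Eventually.of_forall fun n => ⟨_, _, Nat.succ_pos _, Nat.succ_pos _, rfl⟩)
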